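/- Let $\mathcal X$ (nonempty), $\mathcal S,\mathcal Y_1,\mathcal Y_2$ be finite alphabets. Consider a discrete memoryless wiretap channel $p(y_1,y_2\mid x,s)$ with channel input $X$, state $S$, legitimate output $Y_1$ and eavesdropper output $Y_2$, whose state is i.i.d. with law $p(s)$ and known non-causally at the transmitter only. A code of block length $n$ consists of a message set of size $M_n\ge 1$, a stochastic encoder $p(x^n\mid w,s^n)$, and a decoder $y_1^n\mapsto\hat w$; the message $W$ is uniform and independent of $S^n$. A secrecy rate $R$ is achievable if there is a sequence of codes, one for each block length $n$, with $\liminf_{n\to\infty}\frac1n\log_2 M_n\ge R$, $\Pr[\hat W\ne W]\to 0$ and $\frac1n I(W;Y_2^n)\to 0$. The secrecy capacity $C_s$ is the largest achievable secrecy rate. If the legitimate output is a deterministic function of input and state, $Y_1=f(X,S)$ for some $f:\mathcal X\times\mathcal S\to\mathcal Y_1$, then $C_s$ exists (the supremum of the achievable rates is finite and attained) and $$C_s=\max_{p(x\mid s)}\min\{H(Y_1\mid S),\,H(Y_1\mid Y_2)\},$$ where the maximum, over all conditional laws $p(x\mid s)$, is attained, and the entropies (in bits) are computed under $p(s)\,p(x\mid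 s)\,p(y_1,y_2\mid x,s)$. -/

import Mathlib

open Filter Topology

noncomputable section

namespace Wiretap

/-! Information measures of finitely supported joint laws, in bits. A joint law of a pair
`(A, B)` is given by its probability mass function `p : α × β → ℝ`. -/

/-- Conditional entropy `H(A | B) = - ∑ p(a,b) log₂ (p(a,b) / p(b))`, with `0 log 0 = 0`. -/
def condEntropy {α β : Type*} [Fintype α] [Fintype β] (p : α × β → ℝ) : ℝ :=
  - ∑ a, ∑ b, p (a, b) * Real.logb 2 (p (a, b) / ∑ a', p (a', b))

/-- Mutual information `I(A; B) = ∑ p(a,b) log₂ (p(a,b) / (p(a) p(b)))`, with `0 log 0 = 0`. -/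
def mutualInfo {α β : Type*} [Fintype α] [Fintype β] (p : α × β → ℝ) : ℝ :=
  ∑ a, ∑ b, p (a, b) * Real.logb 2 (p (a, b) / ((∑ b', p (a, b')) * ∑ a', p (a', b)))

/-- A discrete memoryless wiretap channel with i.i.d. state: finite alphabets `X` (input),
`S` (state), `Y₁` (legitimate receiver) and `Y₂` (eavesdropper), the law `p(s)` of one state
and the transition probabilities `p(y₁, y₂ | x, s)`. -/
structure Channel (X S Y₁ Y₂ : Type*) [Fintype S] [Fintype Y₁] [Fintype Y₂] where
  /-- the law of the state at each time -/
  state : stdSimplex ℝ S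
  /-- the law of the pair of outputs, given the input and the state -/
  trans : X → S → stdSimplex ℝ (Y₁ × Y₂)

/-- A code of block length `n`: a message set `Fin M` with `M ≥ 1`, a stochastic encoder, which
sees the message and the whole state sequence (non-causal state information), and a decoder,
which sees only the legitimate receiver's output sequence. -/
structure Code (X S Y₁ : Type*) [Fintype X] (n : ℕ) where
  /-- the number of messages -/
  M : ℕ
  M_pos : 0 < M
  /-- the law of the input sequence, given the message and the state sequence -/
  enc : Fin M → (Fin n → S) → stdSimplex ℝ (Fin n → X)
  /-- the decoding rule -/
  dec : (Fin n → Y₁) → Fin M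

/-- The rate `(1/n) log₂ M` of a code, in bits per channel use. -/
def Code.rate {X S Y₁ : Type*} [Fintype X] {n : ℕ} (c : Code X S Y₁ n) : ℝ :=
  Real.logb 2 c.M / n

namespace Channel

variable {X S Y₁ Y₂ : Type*} [Fintype X] [Fintype S] [Fintype Y₁] [Fintype Y₂]

/-- The probability of `W = w`, `Sⁿ = s`, `Xⁿ = x`, `Y₁ⁿ = y₁`, `Y₂ⁿ = y₂` when a code is used:
the message is uniform and independent of the i.i.d. state sequence, and the channel acts
independently on each time index. -/
def blockLaw (ch : Channel X S Y₁ Y₂) {n : ℕ} (c : Code X S Y₁ n) (w : Fin c.M)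
    (s : Fin n → S) (x : Fin n → X) (y₁ : Fin n → Y₁) (y₂ : Fin n → Y₂) : ℝ :=
  (1 / (c.M : ℝ)) * (∏ i, ch.state (s i)) * c.enc w s x * ∏ i, ch.trans (x i) (s i) (y₁ i, y₂ i)

/-- The probability that the decoded message differs from the message sent. -/
def errorProb (ch : Channel X S Y₁ Y₂) {n : ℕ} (c : Code X S Y₁ n) : ℝ :=
  ∑ w, ∑ s, ∑ x, ∑ y₁, ∑ y₂, if c.dec y₁ = w then 0 else ch.blockLaw c w s x y₁ y₂

/-- The information `I(W; Y₂ⁿ)` that the eavesdropper's observation leaks about the message. -/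
def leakage (ch : Channel X S Y₁ Y₂) {n : ℕ} (c : Code X S Y₁ n) : ℝ :=
  mutualInfo fun p : Fin c.M × (Fin n → Y₂) => ∑ s, ∑ x, ∑ y₁, ch.blockLaw c p.1 s x y₁ p.2

/-- `R` is an achievable secrecy rate: some sequence of codes, one for each block length, has
rates with limit inferior at least `R`, error probability tending to zero, and normalized
leakage `(1/n) I(W; Y₂ⁿ)` tending to zero. -/
def Achievable (ch : Channel X S Y₁ Y₂) (R : ℝ) : Prop :=
  ∃ c : (n : ℕ) → Code X S Y₁ n,
    (∀ ε > 0, ∀ᶠ n in atTop, R - ε ≤ (c n).rate) ∧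
    Tendsto (fun n => ch.errorProb (c n)) atTop (𝓝 0) ∧
    Tendsto (fun n : ℕ => ch.leakage (c n) / n) atTop (𝓝 0)

/-- The secrecy capacity: the supremum of the achievable secrecy rates. -/
def secrecyCapacity (ch : Channel X S Y₁ Y₂) : ℝ :=
  sSup {R | ch.Achievable R}

/-- The probability `p(s) p(x|s) p(y₁,y₂|x,s)` in one channel use with input law
`q s x = p(x|s)`. -/
def singleLaw (ch : Channel X S Y₁ Y₂) (q : S → stdSimplex ℝ X)
    (s : S) (x : X) (y₁ : Y₁) (y₂ : Y₂) : ℝ :=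
  ch.state s * q s x * ch.trans x s (y₁, y₂)

/-- `H(Y₁ | S)` under the input law `q`. -/
def entropyGivenState (ch : Channel X S Y₁ Y₂) (q : S → stdSimplex ℝ X) : ℝ :=
  condEntropy fun p : Y₁ × S => ∑ x, ∑ y₂, ch.singleLaw q p.2 x p.1 y₂

/-- `H(Y₁ | Y₂)` under the input law `q`. -/
def entropyGivenEve (ch : Channel X S Y₁ Y₂) (q : S → stdSimplex ℝ X) : ℝ :=
  condEntropy fun p : Y₁ × Y₂ => ∑ s, ∑ x, ch.singleLaw q s x p.1 p.2

/-- The legitimate output is the deterministic function `f` of the input and the state: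
`p(y₁, y₂ | x, s) = 0` unless `y₁ = f x s`. -/
def IsSemiDeterministic (ch : Channel X S Y₁ Y₂) (f : X → S → Y₁) : Prop :=
  ∀ x s y₁ y₂, y₁ ≠ f x s → ch.trans x s (y₁, y₂) = 0

end Channel

end Wiretap

end

/-! The message is a hash of what the legitimate receiver sees. Draw `X^n` i.i.d. from `q` and let
`g : Y₁^n → Fin M` be a uniformly random function. Leftover hashing (`sum_hashDist_le_of_le`), with
Chebyshev's inequality controlling atypical blocks, makes `g(Y₁^n)` nearly uniform and independent
of `S^n` at rates below `H(Y₁|S)`, and of `Y₂^n` at rates below `H(Y₁|Y₂)`; one `g` serves both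
purposes. Since `Y₁ = f(X,S)`, the encoder can predict `Y₁^n`: it draws `X^n` conditionally on the
states and on `g(Y₁^n) = w`, and the decoder is `g` itself. Near independence from `S^n` means that
imposing a uniform message barely changes the i.i.d. joint law, so that near independence from
`Y₂^n` survives as secrecy (`errorProb_hashCode_le`, `leakage_hashCode_le`).

For the converse, `logb_card_le` is applied with side information `S^n`, which is independent of the
message, and with `Y₂^n`, whose information about the message is the leakage. Both block entropies
are at most `n` times the single-letter entropies of one and the same time-averaged law
(`condEntropy_block_le`, `exists_timeAverage`). Its state marginal is exactly `p(s)`, because the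
states are i.i.d. and independent of the message, so it comes from an input law `q`. Compactness of
the set of input laws and continuity of the entropies give the maximum. -/

noncomputable section

set_option linter.unusedSectionVars false

namespace Wiretap

/-! ### Independence, variance and Chebyshev's inequality for finite product weights. -/

section ProductWeights

variable {ι Z : Type*} [Fintype ι] [DecidableEq ι] [Fintype Z]

theorem sum_prod_eq_one (p : ι → Z → ℝ) (hp : ∀ i, ∑ z, p i z = 1) :
    ∑ z : ι → Z, ∏ j, p j (z j) = 1 := by
  rw [← Fintype.prod_sum]
  simp [hp]

theorem sum_prod_mul_apply_mul_apply (p : ι → Z → ℝ) (hp : ∀ i, ∑ z, p i z = 1)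
    {i k : ι} (hik : i ≠ k) (h₁ h₂ : Z → ℝ) :
    ∑ z : ι → Z, (∏ j, p j (z j)) * (h₁ (z i) * h₂ (z k)) =
      (∑ z, p i z * h₁ z) * ∑ z, p k z * h₂ z := by
  have key := Fintype.prod_sum (fun j z => p j z *
    ((if j = i then h₁ z else 1) * (if j = k then h₂ z else 1)))
  have e : ∀ z : ι → Z, ∏ j, (p j (z j) *
      ((if j = i then h₁ (z j) else 1) * (if j = k then h₂ (z j) else 1))) =
      (∏ j, p j (z j)) * (h₁ (z i) * h₂ (z k)) := by
    intro z
    rw [Finset.prod_mul_distrib, Finset.prod_mul_distrib]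
    simp
  simp only [e] at key
  rw [← key]
  have e2 : ∀ j, ∑ z, p j z * ((if j = i then h₁ z else 1) * (if j = k then h₂ z else 1)) =
      (if j = i then ∑ z, p i z * h₁ z else 1) * (if j = k then ∑ z, p k z * h₂ z else 1) := by
    intro j
    by_cases hi : j = i
    · subst hi
      simp [hik]
    · by_cases hk : j = k
      · subst hk
        simp [hi]
      · simp [hi, hk, hp]
  simp only [e2, Finset.prod_mul_distrib]
  simp

theorem sum_prod_mul_apply (p : ι → Z → ℝ) (hp : ∀ i, ∑ z, p i z = 1) (i : ι) (h : Z → ℝ) :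
    ∑ z : ι → Z, (∏ j, p j (z j)) * h (z i) = ∑ z, p i z * h z := by
  have key := Fintype.prod_sum (fun j z => p j z * (if j = i then h z else 1))
  have e : ∀ z : ι → Z, ∏ j, (p j (z j) * (if j = i then h (z j) else 1)) =
      (∏ j, p j (z j)) * h (z i) := by
    intro z
    rw [Finset.prod_mul_distrib]
    simp
  simp only [e] at key
  rw [← key]
  have e2 : ∀ j, ∑ z, p j z * (if j = i then h z else 1) =
      (if j = i then ∑ z, p i z * h z else 1) := by
    intro j
    by_cases hi : j = i
    · subst hi; simp
    · simp [hi, hp]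
  simp only [e2]
  simp

/-- Variance of a sum of independent centred variables. -/
theorem sum_prod_mul_sq (p : ι → Z → ℝ) (hp : ∀ i, ∑ z, p i z = 1) (φ : ι → Z → ℝ)
    (hφ : ∀ i, ∑ z, p i z * φ i z = 0) :
    ∑ z : ι → Z, (∏ j, p j (z j)) * (∑ i, φ i (z i)) ^ 2 = ∑ i, ∑ z, p i z * φ i z ^ 2 := by
  have e : ∀ z : ι → Z, (∏ j, p j (z j)) * (∑ i, φ i (z i)) ^ 2 =
      ∑ i, ∑ k, (∏ j, p j (z j)) * (φ i (z i) * φ k (z k)) := by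
    intro z
    rw [sq, Finset.sum_mul_sum, Finset.mul_sum]
    exact Finset.sum_congr rfl fun i _ => Finset.mul_sum _ _ _
  simp only [e]
  rw [Finset.sum_comm]
  refine Finset.sum_congr rfl fun i _ => ?_
  rw [Finset.sum_comm, Finset.sum_eq_single i]
  · have := sum_prod_mul_apply p hp i (fun z => φ i z * φ i z)
    simpa [sq] using this
  · intro k _ hk
    rw [sum_prod_mul_apply_mul_apply p hp (Ne.symm hk), hφ, zero_mul]
  · simp

/-- Chebyshev's inequality for an i.i.d. sum. -/
theorem sum_prod_ite_le (p : Z → ℝ) (hp0 : ∀ z, 0 ≤ p z) (hp : ∑ z, p z = 1) (φ : Z → ℝ)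
    {n : ℕ} (hn : 0 < n) {t : ℝ} (ht : 0 < t) (T : (Fin n → Z) → Prop) [DecidablePred T]
    (hT : ∀ z, T z → n * t ≤ ∑ i, (φ (z i) - ∑ z, p z * φ z)) :
    (∑ z : Fin n → Z, if T z then ∏ i, p (z i) else 0) ≤
      (∑ z, p z * (φ z - ∑ z, p z * φ z) ^ 2) / t ^ 2 / n := by
  have key := sum_prod_mul_sq (ι := Fin n) (fun _ => p) (fun _ => hp)
    (fun _ z => φ z - ∑ z, p z * φ z) (by
      intro _
      simp only [mul_sub, Finset.sum_sub_distrib]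
      rw [← Finset.sum_mul, hp]; ring)
  simp only [Finset.sum_const, Finset.card_univ, Fintype.card_fin, nsmul_eq_mul] at key
  have hn' : (0 : ℝ) < n := by exact_mod_cast hn
  rw [le_div_iff₀ hn', le_div_iff₀ (by positivity)]
  -- Markov's inequality for the squared deviation, whose mean is `n` times the variance of one
  -- letter.
  have h2 : (∑ z : Fin n → Z, if T z then ∏ i, p (z i) else 0) * (n * t) ^ 2 ≤
      n * ∑ z, p z * (φ z - ∑ z, p z * φ z) ^ 2 := by
    rw [← key, Finset.sum_mul]
    refine Finset.sum_le_sum fun z _ => ?_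
    have hpz : 0 ≤ ∏ i, p (z i) := Finset.prod_nonneg fun i _ => hp0 _
    split_ifs with h
    · exact mul_le_mul_of_nonneg_left (pow_le_pow_left₀ (by positivity) (hT z h) 2) hpz
    · rw [zero_mul]; positivity
  have h3 : n * ((∑ z : Fin n → Z, if T z then ∏ i, p (z i) else 0) * n * t ^ 2) ≤
      n * ∑ z, p z * (φ z - ∑ z, p z * φ z) ^ 2 := by
    refine le_trans (le_of_eq ?_) h2
    ring
  exact le_of_mul_le_mul_left h3 hn'

end ProductWeights

/-! ### Gibbs' inequality and bounds on mutual information. -/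

section Information

/-- One term of Gibbs' inequality, from `log t ≤ t - 1`. Summed, the right side is a difference of
total masses; this drives every entropy inequality below. -/
theorem mul_logb_div_le {p q : ℝ} (hp : 0 ≤ p) (hq : 0 ≤ q) (h : 0 < p → 0 < q) :
    p * Real.logb 2 (q / p) ≤ (q - p) / Real.log 2 := by
  have hl : 0 < Real.log 2 := Real.log_pos one_lt_two
  rcases hp.eq_or_lt with rfl | hp
  · simp; positivity
  · have := Real.log_le_sub_one_of_pos (div_pos (h hp) hp)
    rw [Real.logb, ← mul_div_assoc]
    apply div_le_div_of_nonneg_right _ hl.le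
    calc p * Real.log (q / p) ≤ p * (q / p - 1) := mul_le_mul_of_nonneg_left this hp.le
      _ = q - p := by field_simp

variable {α β : Type*} [Fintype α] [Fintype β]

theorem mutualInfo_nonneg (p : α × β → ℝ) (hp : ∀ z, 0 ≤ p z) (h1 : ∑ a, ∑ b, p (a, b) = 1) :
    0 ≤ mutualInfo p := by
  have hm1 : ∀ a b, p (a, b) ≤ ∑ b', p (a, b') := fun a b =>
    Finset.single_le_sum (f := fun b => p (a, b)) (fun i _ => hp _) (Finset.mem_univ b)
  have hm2 : ∀ a b, p (a, b) ≤ ∑ a', p (a', b) := fun a b =>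
    Finset.single_le_sum (f := fun a => p (a, b)) (fun i _ => hp _) (Finset.mem_univ a)
  have key : ∀ a b, -(p (a, b) *
      Real.logb 2 (p (a, b) / ((∑ b', p (a, b')) * ∑ a', p (a', b)))) ≤
      ((∑ b', p (a, b')) * (∑ a', p (a', b)) - p (a, b)) / Real.log 2 := by
    intro a b
    rw [← mul_neg, ← Real.logb_inv, inv_div]
    exact mul_logb_div_le (hp _)
      (mul_nonneg ((hp (a, b)).trans (hm1 a b)) ((hp (a, b)).trans (hm2 a b)))
      fun h => mul_pos (h.trans_le (hm1 a b)) (h.trans_le (hm2 a b))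
  have h2 := Finset.sum_le_sum fun a (_ : a ∈ Finset.univ) =>
    Finset.sum_le_sum fun b (_ : b ∈ Finset.univ) => key a b
  simp only [← Finset.sum_div, Finset.sum_sub_distrib, Finset.sum_neg_distrib,
    ← Finset.mul_sum] at h2
  rw [← Finset.sum_mul, Finset.sum_comm (f := fun b a => p (a, b)), h1] at h2
  simp only [mul_one, sub_self, zero_div] at h2
  unfold mutualInfo
  linarith

/-- A law close to a product of the uniform law and some other law has small mutual information. -/
theorem mutualInfo_le (M : ℕ) (hM : 0 < M) (p : Fin M × β → ℝ) (hp : ∀ z, 0 ≤ p z)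
    (hunif : ∀ w, ∑ b, p (w, b) = 1 / M) (r : β → ℝ) :
    mutualInfo p ≤ 2 * (∑ w, ∑ b, |p (w, b) - r b / M|) * (Real.logb 2 M + 2) := by
  have hM' : (0 : ℝ) < M := by exact_mod_cast hM
  have hM1 : (1 : ℝ) ≤ M := by exact_mod_cast hM
  have hlM : 0 ≤ Real.logb 2 M := Real.logb_nonneg one_lt_two hM1
  have hl : 0 < Real.log 2 := Real.log_pos one_lt_two
  have hl2 : 1 / Real.log 2 ≤ 2 := by
    rw [div_le_iff₀ hl]; linarith [Real.log_two_gt_d9]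
  have hm2 : ∀ w b, p (w, b) ≤ ∑ w', p (w', b) := fun w b =>
    Finset.single_le_sum (f := fun a => p (a, b)) (fun i _ => hp _) (Finset.mem_univ w)
  have hterm : ∀ w b, p (w, b) * Real.logb 2 (p (w, b) / ((1 / M) * ∑ w', p (w', b))) ≤
      |p (w, b) - (∑ w', p (w', b)) / M| * (Real.logb 2 M + 2) := by
    intro w b
    have hR : 0 ≤ |p (w, b) - (∑ w', p (w', b)) / M| * (Real.logb 2 M + 2) := by positivity
    rcases (hp (w, b)).eq_or_lt with h | h
    · rw [← h, zero_mul]; rw [← h] at hR; exact hR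
    have hB : 0 < ∑ w', p (w', b) := h.trans_le (hm2 w b)
    set B := ∑ w', p (w', b) with hBdef
    set x := p (w, b) with hx
    have hxB : x ≤ B := hm2 w b
    have hq : 1 / (M : ℝ) * B = B / M := by ring
    rw [hq]
    have hqpos : 0 < B / M := by positivity
    -- Below the product law the term is nonpositive. Above it, split `x = (x - B/M) + B/M`: the
    -- first part multiplies a logarithm of at most `log M`, and the second contributes at most `(x
    -- - B/M) / log 2 ≤ 2 (x - B/M)`.
    by_cases hle : x ≤ B / M
    · refine le_trans (mul_nonpos_of_nonneg_of_nonpos h.le ?_) hR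
      exact Real.logb_nonpos one_lt_two (by positivity) (by rw [div_le_one hqpos]; exact hle)
    · push Not at hle
      rw [abs_of_pos (sub_pos.2 hle)]
      have h1 : Real.logb 2 (x / (B / M)) ≤ Real.logb 2 M := by
        apply Real.logb_le_logb_of_le one_lt_two (by positivity)
        rw [div_le_iff₀ hqpos]
        have : (M : ℝ) * (B / M) = B := by field_simp
        rw [this]; exact hxB
      have h2 : (B / M) * Real.logb 2 (x / (B / M)) ≤ (x - B / M) / Real.log 2 :=
        mul_logb_div_le hqpos.le h.le (fun _ => h)
      have h3 : (x - B / M) / Real.log 2 ≤ (x - B / M) * 2 := by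
        rw [div_eq_mul_one_div]
        exact mul_le_mul_of_nonneg_left hl2 (sub_pos.2 hle).le
      have h4 := mul_le_mul_of_nonneg_left h1 (sub_pos.2 hle).le
      nlinarith
  -- Since `r` need not be the marginal of `p`, replacing it by that marginal adds the error
  -- averaged over `w'`; this is the factor 2.
  have htri : ∀ w b, |p (w, b) - (∑ w', p (w', b)) / M| ≤
      |p (w, b) - r b / M| + (1 / M) * ∑ w', |p (w', b) - r b / M| := by
    intro w b
    have e : p (w, b) - (∑ w', p (w', b)) / M =
        (p (w, b) - r b / M) - (1 / M) * ∑ w', (p (w', b) - r b / M) := by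
      rw [Finset.sum_sub_distrib]
      simp
      field_simp
      ring
    rw [e]
    refine (abs_sub _ _).trans (add_le_add le_rfl ?_)
    rw [abs_mul, abs_of_pos (by positivity : (0 : ℝ) < 1 / M)]
    exact mul_le_mul_of_nonneg_left (Finset.abs_sum_le_sum_abs _ _) (by positivity)
  have hsum : ∑ w, ∑ b, |p (w, b) - (∑ w', p (w', b)) / M| ≤
      2 * ∑ w, ∑ b, |p (w, b) - r b / M| := by
    refine (Finset.sum_le_sum fun w _ => Finset.sum_le_sum fun b _ => htri w b).trans
      (le_of_eq ?_)
    simp only [Finset.sum_add_distrib, ← Finset.mul_sum]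
    rw [Finset.sum_const, Finset.sum_comm (f := fun b w' => |p (w', b) - r b / M|)]
    rw [Finset.sum_comm]
    simp only [Finset.card_univ, Fintype.card_fin, nsmul_eq_mul]
    rw [← mul_assoc, one_div_mul_cancel hM'.ne', one_mul, ← two_mul]
  unfold mutualInfo
  simp only [hunif]
  refine (Finset.sum_le_sum fun w _ => Finset.sum_le_sum fun b _ => hterm w b).trans ?_
  simp only [← Finset.sum_mul]
  exact mul_le_mul_of_nonneg_right hsum (by positivity)

end Information

/-! ### Random hash functions and the leftover hash lemma. -/

section Hashing

variable {A B : Type*} [Fintype A] [Fintype B]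

/-- The `ℓ¹` distance between the law of `(g(A), B)` and the product of the uniform law on
`Fin M` with the law of `B`. -/
def hashDist (p : A → B → ℝ) {M : ℕ} (g : A → Fin M) : ℝ :=
  ∑ w, ∑ b, |(∑ a, if g a = w then p a b else 0) - (∑ a, p a b) / M|

theorem hashDist_nonneg (p : A → B → ℝ) {M : ℕ} (g : A → Fin M) : 0 ≤ hashDist p g :=
  Finset.sum_nonneg fun _ _ => Finset.sum_nonneg fun _ _ => abs_nonneg _

theorem hashDist_one (p : A → B → ℝ) (g : A → Fin 1) : hashDist p g = 0 := by
  simp [hashDist, Subsingleton.elim (g _) 0]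

/-- The discarded mass counts twice: once in the hashed law, once in the product law. -/
theorem hashDist_triangle (p q : A → B → ℝ) (hq : ∀ a b, q a b ≤ p a b) {M : ℕ} (hM : 0 < M)
    (g : A → Fin M) :
    hashDist p g ≤ hashDist q g + 2 * ∑ a, ∑ b, (p a b - q a b) := by
  have hM' : (0 : ℝ) < M := by exact_mod_cast hM
  have h : ∀ w b, |(∑ a, if g a = w then p a b else 0) - (∑ a, p a b) / M| ≤
      |(∑ a, if g a = w then q a b else 0) - (∑ a, q a b) / M| +
      ((∑ a, if g a = w then p a b - q a b else 0) + (∑ a, (p a b - q a b)) / M) := by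
    intro w b
    have e1 : (∑ a, if g a = w then p a b - q a b else 0) =
        (∑ a, if g a = w then p a b else 0) - ∑ a, if g a = w then q a b else 0 := by
      rw [← Finset.sum_sub_distrib]
      exact Finset.sum_congr rfl fun a _ => by split_ifs <;> simp
    have h1 : 0 ≤ ∑ a, if g a = w then p a b - q a b else 0 :=
      Finset.sum_nonneg fun a _ => by
        split_ifs
        · exact sub_nonneg.2 (hq a b)
        · exact le_rfl
    have h2 : 0 ≤ (∑ a, (p a b - q a b)) / M :=
      div_nonneg (Finset.sum_nonneg fun a _ => sub_nonneg.2 (hq a b)) hM'.le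
    have e2 : (∑ a, (p a b - q a b)) / M = (∑ a, p a b) / M - (∑ a, q a b) / M := by
      rw [Finset.sum_sub_distrib, sub_div]
    rw [e1] at h1 ⊢
    rw [e2] at h2 ⊢
    rw [abs_le]
    constructor
    · linarith [neg_abs_le ((∑ a, if g a = w then q a b else 0) - (∑ a, q a b) / M)]
    · linarith [le_abs_self ((∑ a, if g a = w then q a b else 0) - (∑ a, q a b) / M)]
  refine (Finset.sum_le_sum fun w _ => Finset.sum_le_sum fun b _ => h w b).trans (le_of_eq ?_)
  simp only [Finset.sum_add_distrib]
  have e3 : ∑ w : Fin M, ∑ b, (∑ a, if g a = w then p a b - q a b else 0) =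
      ∑ a, ∑ b, (p a b - q a b) := by
    rw [Finset.sum_comm, Finset.sum_comm (s := (Finset.univ : Finset A))]
    refine Finset.sum_congr rfl fun b _ => ?_
    rw [Finset.sum_comm]
    simp
  have e4 : ∑ w : Fin M, ∑ b, (∑ a, (p a b - q a b)) / M = ∑ a, ∑ b, (p a b - q a b) := by
    rw [Finset.sum_comm (s := (Finset.univ : Finset A))]
    simp only [Finset.sum_const, Finset.card_univ, Fintype.card_fin, nsmul_eq_mul,
      ← Finset.sum_div]
    field_simp
  rw [e3, e4, hashDist]
  ring

/-- Leftover hashing: a uniformly random function extracts nearly uniform values. -/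
theorem sum_hashDist_le_of_le [DecidableEq A] (q : A → B → ℝ) (hq : ∀ a b, 0 ≤ q a b)
    {τ : ℝ} (hτ : 0 ≤ τ) (r : B → ℝ) (hr : ∀ b, 0 ≤ r b) (hr1 : ∑ b, r b ≤ 1)
    (hqr : ∀ b, ∑ a, q a b ≤ r b) (hqτ : ∀ a b, q a b ≤ τ * r b) {M : ℕ} (hM : 0 < M) :
    ∑ g : A → Fin M, (∏ _a : A, (1 / M : ℝ)) * hashDist q g ≤ √(M * τ) := by
  have hM' : (0 : ℝ) < M := by exact_mod_cast hM
  have hunif : ∑ _w : Fin M, (1 / M : ℝ) = 1 := by simp; field_simp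
  have hw : ∑ g : A → Fin M, (∏ _a : A, (1 / M : ℝ)) = 1 :=
    sum_prod_eq_one (fun (_ : A) (_ : Fin M) => (1 / M : ℝ)) fun _ => hunif
  have hterm : ∀ (w : Fin M) (b : B), ∑ g : A → Fin M, (∏ _a : A, (1 / M : ℝ)) *
      |(∑ a, if g a = w then q a b else 0) - (∑ a, q a b) / M| ≤ r b * √(τ / M) := by
    intro w b
    have e : ∀ g : A → Fin M, (∑ a, if g a = w then q a b else 0) - (∑ a, q a b) / M =
        ∑ a, q a b * ((if g a = w then 1 else 0) - 1 / M) := by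
      intro g
      simp only [mul_sub, Finset.sum_sub_distrib, ← Finset.sum_mul]
      simp [div_eq_mul_inv]
    -- The values `g a` are independent and uniform, so the centred indicators contribute only their
    -- variances; Jensen then passes from squares to absolute values.
    have hvar := sum_prod_mul_sq (fun (_ : A) (_ : Fin M) => (1 / M : ℝ)) (fun _ => hunif)
      (fun a z => q a b * ((if z = w then 1 else 0) - 1 / M)) (by
        intro a
        rw [← Finset.mul_sum, ← Finset.mul_sum, Finset.sum_sub_distrib, hunif]
        simp)
    have hjen := Real.pow_arith_mean_le_arith_mean_pow (Finset.univ : Finset (A → Fin M))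
      (fun _ => ∏ _a : A, (1 / M : ℝ))
      (fun g => |∑ a, q a b * ((if g a = w then 1 else 0) - 1 / M)|)
      (fun _ _ => by positivity) hw (fun _ _ => abs_nonneg _) 2
    simp only [sq_abs] at hjen
    rw [hvar] at hjen
    simp only [e]
    have hle : ∑ a, ∑ z : Fin M, 1 / (M : ℝ) * (q a b * ((if z = w then 1 else 0) - 1 / M)) ^ 2 ≤
        (r b * √(τ / M)) ^ 2 := by
      have h1 : ∀ a, ∑ z : Fin M,
          1 / (M : ℝ) * (q a b * ((if z = w then 1 else 0) - 1 / M)) ^ 2 ≤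
          q a b * (τ * r b) / M := by
        intro a
        have e2 : ∀ z : Fin M, 1 / (M : ℝ) * (q a b * ((if z = w then 1 else 0) - 1 / M)) ^ 2 =
            q a b ^ 2 / M * ((if z = w then 1 - 2 / (M : ℝ) else 0) + 1 / M * (1 / M)) := by
          intro z
          split_ifs <;> ring
        have e3 : ∑ z : Fin M, ((if z = w then 1 - 2 / (M : ℝ) else 0) + 1 / M * (1 / M)) =
            1 - 1 / M := by
          rw [Finset.sum_add_distrib, ← Finset.sum_mul, hunif]
          simp
          ring
        simp only [e2]
        rw [← Finset.mul_sum, e3]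
        have h2 : q a b ^ 2 ≤ q a b * (τ * r b) := by
          rw [sq]; exact mul_le_mul_of_nonneg_left (hqτ a b) (hq a b)
        have h3 : (1 : ℝ) - 1 / M ≤ 1 := by
          have : (0 : ℝ) < 1 / M := by positivity
          linarith
        calc q a b ^ 2 / M * (1 - 1 / M) ≤ q a b ^ 2 / M * 1 :=
              mul_le_mul_of_nonneg_left h3 (by positivity)
          _ ≤ _ := by rw [mul_one]; exact div_le_div_of_nonneg_right h2 hM'.le
      refine (Finset.sum_le_sum fun a _ => h1 a).trans ?_
      rw [← Finset.sum_div, ← Finset.sum_mul, mul_pow, Real.sq_sqrt (by positivity)]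
      have h4 : (∑ a, q a b) * (τ * r b) ≤ r b * (τ * r b) :=
        mul_le_mul_of_nonneg_right (hqr b) (mul_nonneg hτ (hr b))
      calc (∑ a, q a b) * (τ * r b) / M ≤ r b * (τ * r b) / M :=
            div_le_div_of_nonneg_right h4 hM'.le
        _ = _ := by ring
    exact le_of_sq_le_sq (hjen.trans hle) (mul_nonneg (hr b) (Real.sqrt_nonneg _))
  have hswap : ∑ g : A → Fin M, (∏ _a : A, (1 / M : ℝ)) * hashDist q g =
      ∑ w : Fin M, ∑ b, ∑ g : A → Fin M, (∏ _a : A, (1 / M : ℝ)) *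
      |(∑ a, if g a = w then q a b else 0) - (∑ a, q a b) / M| := by
    simp only [hashDist, Finset.mul_sum]
    rw [Finset.sum_comm]
    exact Finset.sum_congr rfl fun w _ => Finset.sum_comm
  rw [hswap]
  refine (Finset.sum_le_sum fun w _ => Finset.sum_le_sum fun b _ => hterm w b).trans ?_
  simp only [← Finset.sum_mul]
  rw [Finset.sum_const, Finset.card_univ, Fintype.card_fin, nsmul_eq_mul]
  have e5 : √((M : ℝ) * τ) = M * √(τ / M) := by
    have : (M : ℝ) * τ = M ^ 2 * (τ / M) := by field_simp
    rw [this, Real.sqrt_mul (by positivity), Real.sqrt_sq hM'.le]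
  rw [e5]
  have h6 : 0 ≤ √(τ / M) := Real.sqrt_nonneg _
  nlinarith [mul_le_mul_of_nonneg_right hr1 h6, mul_nonneg hM'.le h6]

open Classical in
-- Pairs with conditional probability `p(a|b)` above `τ` are cut off: the rest obeys leftover
-- hashing relative to the marginal of `p`, and the loss is paid through `hashDist_triangle`.
theorem sum_hashDist_le [DecidableEq A] (p : A → B → ℝ) (hp : ∀ a b, 0 ≤ p a b)
    (hp1 : ∑ b, ∑ a, p a b = 1) {τ : ℝ} (hτ : 0 ≤ τ) {M : ℕ} (hM : 0 < M) :
    ∑ g : A → Fin M, (∏ _a : A, (1 / M : ℝ)) * hashDist p g ≤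
      √(M * τ) + 2 * ∑ a, ∑ b, if τ * (∑ a', p a' b) < p a b then p a b else 0 := by
  have hM' : (0 : ℝ) < M := by exact_mod_cast hM
  set q : A → B → ℝ := fun a b => if τ * (∑ a', p a' b) < p a b then 0 else p a b with hqdef
  have hunif : ∑ _w : Fin M, (1 / M : ℝ) = 1 := by simp; field_simp
  have hw : ∑ g : A → Fin M, (∏ _a : A, (1 / M : ℝ)) = 1 :=
    sum_prod_eq_one (fun (_ : A) (_ : Fin M) => (1 / M : ℝ)) fun _ => hunif
  have hqp : ∀ a b, q a b ≤ p a b := fun a b => by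
    simp only [hqdef]; split_ifs; exacts [hp a b, le_rfl]
  have hrn : ∀ b, 0 ≤ ∑ a', p a' b := fun b => Finset.sum_nonneg fun a _ => hp a b
  have h1 := sum_hashDist_le_of_le q
    (fun a b => by simp only [hqdef]; split_ifs; exacts [le_rfl, hp a b]) hτ
    (fun b => ∑ a', p a' b) hrn hp1.le (fun b => Finset.sum_le_sum fun a _ => hqp a b)
    (fun a b => by
      simp only [hqdef]; split_ifs with h
      · exact mul_nonneg hτ (hrn b)
      · exact not_lt.1 h) hM
  have h2 : ∑ g : A → Fin M, (∏ _a : A, (1 / M : ℝ)) * hashDist p g ≤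
      ∑ g : A → Fin M, (∏ _a : A, (1 / M : ℝ)) *
        (hashDist q g + 2 * ∑ a, ∑ b, (p a b - q a b)) :=
    Finset.sum_le_sum fun g _ => mul_le_mul_of_nonneg_left
      (hashDist_triangle p q hqp hM g) (Finset.prod_nonneg fun _ _ => by positivity)
  simp only [mul_add, Finset.sum_add_distrib] at h2
  rw [← Finset.sum_mul, hw, one_mul] at h2
  refine h2.trans (add_le_add h1 (le_of_eq ?_))
  congr 1
  refine Finset.sum_congr rfl fun a _ => Finset.sum_congr rfl fun b _ => ?_
  simp only [hqdef]; split_ifs <;> simp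

/-- One hash function that works for two joint laws at once. -/
theorem exists_hashDist_add_le {B' : Type*} [Fintype B'] (p : A → B → ℝ) (p' : A → B' → ℝ)
    {M : ℕ} (hM : 0 < M) {c c' : ℝ}
    (h : ∀ [DecidableEq A], ∑ g : A → Fin M, (∏ _a : A, (1 / M : ℝ)) * hashDist p g ≤ c)
    (h' : ∀ [DecidableEq A], ∑ g : A → Fin M, (∏ _a : A, (1 / M : ℝ)) * hashDist p' g ≤ c') :
    ∃ g : A → Fin M, hashDist p g + hashDist p' g ≤ c + c' := by
  classical
  have hM' : (0 : ℝ) < M := by exact_mod_cast hM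
  have hunif : ∑ _w : Fin M, (1 / M : ℝ) = 1 := by simp; field_simp
  have hw : ∑ g : A → Fin M, (∏ _a : A, (1 / M : ℝ)) = 1 :=
    sum_prod_eq_one (fun (_ : A) (_ : Fin M) => (1 / M : ℝ)) fun _ => hunif
  have : Nonempty (Fin M) := ⟨⟨0, hM⟩⟩
  have h3 : ∑ g : A → Fin M, (∏ _a : A, (1 / M : ℝ)) * (hashDist p g + hashDist p' g) ≤
      ∑ g : A → Fin M, (∏ _a : A, (1 / M : ℝ)) * (c + c') := by
    rw [← Finset.sum_mul, hw, one_mul]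
    simp only [mul_add, Finset.sum_add_distrib]
    exact add_le_add h h'
  obtain ⟨g, -, hg⟩ := Finset.exists_le_of_sum_le Finset.univ_nonempty h3
  exact ⟨g, le_of_mul_le_mul_left hg (Finset.prod_pos fun _ _ => by positivity)⟩

end Hashing

/-! ### Hashing of memoryless sources. -/

section Blocks

variable {A B : Type*} [Fintype A] [Fintype B]

theorem sum_pi_prod {n : ℕ} (F : (Fin n → A) → (Fin n → B) → ℝ) :
    ∑ a, ∑ b, F a b = ∑ z : Fin n → A × B, F (fun i => (z i).1) (fun i => (z i).2) := by
  rw [← Fintype.sum_prod_type' (f := F)]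
  exact (Equiv.sum_comp (Equiv.arrowProdEquivProdArrow (Fin n) (fun _ => A) (fun _ => B))
    (fun x => F x.1 x.2)).symm

/-- A memoryless law on blocks is extracted almost uniformly at rates below the conditional
entropy, on average over hash functions. -/
theorem eventually_sum_hashDist_le (p : A × B → ℝ) (hp : ∀ z, 0 ≤ p z)
    (hp1 : ∑ z, p z = 1) {R ε δ : ℝ} (hε : 0 < ε) (hδ : 0 < δ)
    (hR : R ≤ condEntropy p) :
    ∀ᶠ n : ℕ in atTop, ∀ M : ℕ, 0 < M → (M : ℝ) ≤ 2 * 2 ^ ((n : ℝ) * (R - ε)) →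
      ∀ [DecidableEq (Fin n → A)], ∑ g : (Fin n → A) → Fin M, (∏ _a : Fin n → A, (1 / M : ℝ)) *
        hashDist (fun (a : Fin n → A) (b : Fin n → B) => ∏ i, p (a i, b i)) g ≤ δ := by
  classical
  set φ : A × B → ℝ := fun z => Real.logb 2 (p z / ∑ a', p (a', z.2)) with hφ
  have hmean : ∑ z, p z * φ z = - condEntropy p := by
    rw [condEntropy, neg_neg, Fintype.sum_prod_type]
  set V := (∑ z, p z * (φ z - ∑ z, p z * φ z) ^ 2) / (ε / 2) ^ 2 with hV
  have hlim1 : Tendsto (fun n : ℕ => 2 * (V / n)) atTop (𝓝 0) := by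
    simpa using (tendsto_const_div_atTop_nhds_zero_nat V).const_mul 2
  have hlim2 : Tendsto (fun n : ℕ => √(2 * (2 ^ (-(ε / 2)) : ℝ) ^ n)) atTop (𝓝 0) := by
    have h1 : Tendsto (fun n : ℕ => 2 * ((2 : ℝ) ^ (-(ε / 2))) ^ n) atTop (𝓝 0) := by
      simpa using (tendsto_pow_atTop_nhds_zero_of_lt_one (by positivity)
        (Real.rpow_lt_one_of_one_lt_of_neg one_lt_two (by linarith : -(ε / 2) < 0))).const_mul 2
    simpa using h1.sqrt
  have hlim := hlim2.add hlim1
  rw [add_zero] at hlim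
  filter_upwards [hlim.eventually_lt_const hδ, eventually_gt_atTop 0] with n hn hn0 M hM hMle _
  have hn' : (0 : ℝ) < n := by exact_mod_cast hn0
  -- The slack `ε` is halved: `M * τ ≤ 2 * 2 ^ (-nε/2)`, while a conditional probability above `τ`
  -- forces the log-likelihood at least `nε/2` above its mean `-n H(A|B)`.
  set τ : ℝ := 2 ^ (-((n : ℝ) * (R - ε / 2))) with hτ
  have hτpos : 0 < τ := by positivity
  have hmarg : ∀ b : Fin n → B, ∑ a : Fin n → A, ∏ i, p (a i, b i) = ∏ i, ∑ a, p (a, b i) :=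
    fun b => (Fintype.prod_sum fun i a => p (a, b i)).symm
  have hPp : ∀ (a : Fin n → A) (b : Fin n → B), 0 ≤ ∏ i, p (a i, b i) :=
    fun a b => Finset.prod_nonneg fun i _ => hp _
  have hP1 : ∑ b : Fin n → B, ∑ a : Fin n → A, ∏ i, p (a i, b i) = 1 := by
    rw [Finset.sum_comm, sum_pi_prod]
    exact sum_prod_eq_one (fun _ => p) fun _ => hp1
  have h := sum_hashDist_le (fun (a : Fin n → A) (b : Fin n → B) => ∏ i, p (a i, b i)) hPp hP1
    hτpos.le hM
  refine h.trans (le_trans (add_le_add ?_ ?_) hn.le)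
  · apply Real.sqrt_le_sqrt
    calc (M : ℝ) * τ ≤ 2 * 2 ^ ((n : ℝ) * (R - ε)) * τ :=
          mul_le_mul_of_nonneg_right hMle hτpos.le
      _ = _ := by
        rw [hτ, mul_assoc, ← Real.rpow_add two_pos, ← Real.rpow_natCast, ← Real.rpow_mul two_pos.le]
        congr 2
        ring
  · refine mul_le_mul_of_nonneg_left ?_ two_pos.le
    rw [sum_pi_prod]
    refine sum_prod_ite_le p hp hp1 φ hn0 (half_pos hε) _ fun z hz => ?_
    rw [hmarg] at hz
    have hBn : ∀ i, 0 ≤ ∑ a, p (a, (z i).2) := fun i => Finset.sum_nonneg fun a _ => hp _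
    -- The strict inequality in the atypical event excludes zero factors, so the logarithm of the
    -- product expands.
    have hpos : 0 < ∏ i, p (z i) :=
      (mul_nonneg hτpos.le (Finset.prod_nonneg fun i _ => hBn i)).trans_lt hz
    have hpi : ∀ i, 0 < p (z i) := fun i => (hp _).lt_of_ne fun h0 =>
      hpos.ne' (Finset.prod_eq_zero (Finset.mem_univ i) h0.symm)
    have hBi : ∀ i, 0 < ∑ a, p (a, (z i).2) := fun i => (hpi i).trans_le
      (Finset.single_le_sum (f := fun a => p (a, (z i).2)) (fun _ _ => hp _)
        (Finset.mem_univ (z i).1))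
    have hsum : ∑ i, φ (z i) = Real.logb 2 ((∏ i, p (z i)) / ∏ i, ∑ a, p (a, (z i).2)) := by
      rw [← Finset.prod_div_distrib, Real.logb_prod]
      exact fun i _ => (div_pos (hpi i) (hBi i)).ne'
    have hlog : -((n : ℝ) * (R - ε / 2)) ≤ ∑ i, φ (z i) := by
      rw [hsum, Real.le_logb_iff_rpow_le one_lt_two
        (div_pos hpos (Finset.prod_pos fun i _ => hBi i)),
        le_div_iff₀ (Finset.prod_pos fun i _ => hBi i)]
      exact hz.le
    rw [Finset.sum_sub_distrib, hmean]
    simp only [Finset.sum_const, Finset.card_univ, Fintype.card_fin, nsmul_eq_mul]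
    nlinarith
end Blocks

/-! ### Block marginals and the hash code. -/

namespace Channel

variable {X S Y₁ Y₂ : Type*} [Fintype X] [Fintype S] [Fintype Y₁] [Fintype Y₂]

section BlockMarginals

variable (ch : Channel X S Y₁ Y₂) {n : ℕ}

theorem prod_trans_nonneg (x : Fin n → X) (s : Fin n → S) (a : Fin n → Y₁) (b : Fin n → Y₂) :
    0 ≤ ∏ i, ch.trans (x i) (s i) (a i, b i) :=
  Finset.prod_nonneg fun _ _ => stdSimplex.zero_le _ _

theorem prod_state_nonneg (s : Fin n → S) : 0 ≤ ∏ i, ch.state (s i) :=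
  Finset.prod_nonneg fun _ _ => stdSimplex.zero_le _ _

theorem sum_prod_state : ∑ s : Fin n → S, ∏ i, ch.state (s i) = 1 :=
  sum_prod_eq_one (fun _ : Fin n => ⇑ch.state) fun _ => stdSimplex.sum_eq_one _

theorem sum_prod_trans (x : Fin n → X) (s : Fin n → S) :
    ∑ a : Fin n → Y₁, ∑ b : Fin n → Y₂, ∏ i, ch.trans (x i) (s i) (a i, b i) = 1 := by
  rw [sum_pi_prod]
  exact sum_prod_eq_one (fun i : Fin n => ⇑(ch.trans (x i) (s i)))
    fun _ => stdSimplex.sum_eq_one _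

variable {ch} {f : X → S → Y₁}

/-- The block transition probability vanishes unless `a` is the image of `(x, s)`, so any function
of the output may be evaluated at that image. -/
theorem IsSemiDeterministic.mul_prod_trans (hf : ch.IsSemiDeterministic f)
    (h : (Fin n → Y₁) → ℝ) (x : Fin n → X) (s : Fin n → S) (a : Fin n → Y₁) (b : Fin n → Y₂) :
    h a * ∏ i, ch.trans (x i) (s i) (a i, b i) =
      h (fun i => f (x i) (s i)) * ∏ i, ch.trans (x i) (s i) (a i, b i) := by
  by_cases hi : ∃ i, a i ≠ f (x i) (s i)
  · obtain ⟨i, hi⟩ := hi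
    rw [Finset.prod_eq_zero (Finset.mem_univ i) (hf _ _ _ (b i) hi), mul_zero, mul_zero]
  · push Not at hi
    rw [← funext hi]

variable (ch) (q : S → stdSimplex ℝ X)

theorem prod_singleLaw (s : Fin n → S) (x : Fin n → X) (a : Fin n → Y₁) (b : Fin n → Y₂) :
    ∏ i, ch.singleLaw q (s i) (x i) (a i) (b i) = (∏ i, ch.state (s i)) *
      (∏ i, q (s i) (x i)) * ∏ i, ch.trans (x i) (s i) (a i, b i) := by
  simp only [singleLaw, Finset.prod_mul_distrib]

theorem prod_law_output_state (s : Fin n → S) (a : Fin n → Y₁) :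
    ∏ i, (∑ x, ∑ y₂, ch.singleLaw q (s i) x (a i) y₂) =
      ∑ x : Fin n → X, ∑ b : Fin n → Y₂, (∏ i, ch.state (s i)) *
      (∏ i, q (s i) (x i)) * ∏ i, ch.trans (x i) (s i) (a i, b i) := by
  simp only [← prod_singleLaw]
  rw [sum_pi_prod (F := fun x b => ∏ i, ch.singleLaw q (s i) (x i) (a i) (b i)),
    ← Fintype.prod_sum fun i (z : X × Y₂) => ch.singleLaw q (s i) z.1 (a i) z.2]
  simp only [Fintype.sum_prod_type]

theorem prod_law_outputs (a : Fin n → Y₁) (b : Fin n → Y₂) :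
    ∏ i, (∑ s, ∑ x, ch.singleLaw q s x (a i) (b i)) =
      ∑ s : Fin n → S, ∑ x : Fin n → X, (∏ i, ch.state (s i)) *
      (∏ i, q (s i) (x i)) * ∏ i, ch.trans (x i) (s i) (a i, b i) := by
  simp only [← prod_singleLaw]
  rw [sum_pi_prod (F := fun s x => ∏ i, ch.singleLaw q (s i) (x i) (a i) (b i)),
    ← Fintype.prod_sum fun i (z : S × X) => ch.singleLaw q z.1 z.2 (a i) (b i)]
  simp only [Fintype.sum_prod_type]

variable {ch}

theorem IsSemiDeterministic.sum_mul_law_output_state (hf : ch.IsSemiDeterministic f)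
    (h : (Fin n → Y₁) → ℝ) (s : Fin n → S) :
    ∑ a, h a * ∏ i, (∑ x, ∑ y₂, ch.singleLaw q (s i) x (a i) y₂) =
      (∏ i, ch.state (s i)) *
        ∑ x : Fin n → X, (∏ i, q (s i) (x i)) * h fun i => f (x i) (s i) := by
  simp only [prod_law_output_state, Finset.mul_sum]
  rw [Finset.sum_comm]
  refine Finset.sum_congr rfl fun x _ => ?_
  have e : ∀ (a : Fin n → Y₁) (b : Fin n → Y₂), h a * ((∏ i, ch.state (s i)) *
      (∏ i, q (s i) (x i)) * ∏ i, ch.trans (x i) (s i) (a i, b i)) =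
      (∏ i, ch.state (s i)) * ((∏ i, q (s i) (x i)) * h fun i => f (x i) (s i)) *
        ∏ i, ch.trans (x i) (s i) (a i, b i) := by
    intro a b
    linear_combination (∏ i, ch.state (s i)) * (∏ i, q (s i) (x i)) * hf.mul_prod_trans h x s a b
  simp only [e, ← Finset.mul_sum]
  rw [sum_prod_trans, mul_one]

theorem sum_prod_input (s : Fin n → S) : ∑ x : Fin n → X, ∏ i, q (s i) (x i) = 1 :=
  sum_prod_eq_one (fun i : Fin n => ⇑(q (s i))) fun _ => stdSimplex.sum_eq_one _

end BlockMarginals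

section HashCode

variable [Nonempty X] (f : X → S → Y₁) (q : S → stdSimplex ℝ X) {n M : ℕ}
  (g : (Fin n → Y₁) → Fin M)

/-- The probability that the hash of the legitimate output is `w`, given the states, when the
inputs are drawn independently from `q`. -/
def hashProb (w : Fin M) (s : Fin n → S) : ℝ :=
  ∑ x : Fin n → X, if g (fun i => f (x i) (s i)) = w then ∏ i, q (s i) (x i) else 0

theorem ite_prod_nonneg (w : Fin M) (s : Fin n → S) (x : Fin n → X) :
    0 ≤ if g (fun i => f (x i) (s i)) = w then ∏ i, q (s i) (x i) else 0 := by
  split_ifs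
  · exact Finset.prod_nonneg fun _ _ => stdSimplex.zero_le _ _
  · exact le_rfl

/-- The encoder drawing the inputs from `q`, conditionally on the states and on the hash of the
legitimate output being the message. -/
def hashEnc (w : Fin M) (s : Fin n → S) : stdSimplex ℝ (Fin n → X) :=
  -- When no input block of positive probability hashes to `w`, the choice is arbitrary; only here
  -- can decoding fail.
  if h : hashProb f q g w s = 0 then Classical.arbitrary _
  else ⟨fun x => (if g (fun i => f (x i) (s i)) = w then ∏ i, q (s i) (x i) else 0) /
      hashProb f q g w s,
    fun x => div_nonneg (ite_prod_nonneg f q g w s x)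
      (Finset.sum_nonneg fun x _ => ite_prod_nonneg f q g w s x),
    by rw [← Finset.sum_div]; exact div_self h⟩

theorem hashEnc_apply_of_ne_zero {w : Fin M} {s : Fin n → S} (h : hashProb f q g w s ≠ 0)
    (x : Fin n → X) : hashEnc f q g w s x =
      (if g (fun i => f (x i) (s i)) = w then ∏ i, q (s i) (x i) else 0) /
        hashProb f q g w s := by
  rw [hashEnc, dif_neg h]
  rfl

/-- Valid even for the arbitrary default: if `hashProb` is zero, so are all its nonnegative
summands. -/
theorem hashProb_mul_hashEnc (w : Fin M) (s : Fin n → S) (x : Fin n → X) :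
    hashProb f q g w s * hashEnc f q g w s x =
      if g (fun i => f (x i) (s i)) = w then ∏ i, q (s i) (x i) else 0 := by
  by_cases h : hashProb f q g w s = 0
  · rw [h, zero_mul]
    exact ((Finset.sum_eq_zero_iff_of_nonneg
      fun x _ => ite_prod_nonneg f q g w s x).1 h x (Finset.mem_univ x)).symm
  · rw [hashEnc_apply_of_ne_zero f q g h, mul_div_cancel₀ _ h]

/-- The code that uses a hash of the legitimate output sequence as the message. -/
def hashCode (hM : 0 < M) : Code X S Y₁ n where
  M := M
  M_pos := hM
  enc := hashEnc f q g
  dec := g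

variable {f} {ch : Channel X S Y₁ Y₂} (hf : ch.IsSemiDeterministic f)

/-- The joint law of the legitimate output block and the state block for i.i.d. inputs. -/
abbrev outputStateLaw (ch : Channel X S Y₁ Y₂) (q : S → stdSimplex ℝ X) (n : ℕ)
    (a : Fin n → Y₁) (s : Fin n → S) : ℝ :=
  ∏ i, ∑ x, ∑ y₂, ch.singleLaw q (s i) x (a i) y₂

/-- The joint law of the two output blocks for i.i.d. inputs. -/
abbrev outputsLaw (ch : Channel X S Y₁ Y₂) (q : S → stdSimplex ℝ X) (n : ℕ)
    (a : Fin n → Y₁) (b : Fin n → Y₂) : ℝ :=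
  ∏ i, ∑ s, ∑ x, ch.singleLaw q s x (a i) (b i)

include hf

theorem hashDist_outputStateLaw :
    hashDist (outputStateLaw ch q n) g = ∑ w, ∑ s : Fin n → S,
      |(∏ i, ch.state (s i)) * hashProb f q g w s - (∏ i, ch.state (s i)) / M| := by
  unfold hashDist
  refine Finset.sum_congr rfl fun w _ => Finset.sum_congr rfl fun s _ => ?_
  have h1 := hf.sum_mul_law_output_state q (fun a => if g a = w then 1 else 0) s
  have h2 := hf.sum_mul_law_output_state q (fun _ => 1) s
  simp only [ite_mul, mul_ite, one_mul, zero_mul, mul_one, mul_zero, sum_prod_input] at h1 h2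
  rw [h1, h2, hashProb]

/-- An error requires `hashProb` to vanish at `(w, s)`, and then the corresponding term of the
distance is `p(s)/M`, the whole probability of `(w, s)`. -/
theorem errorProb_hashCode_le (hM : 0 < M) :
    ch.errorProb (hashCode f q g hM) ≤ hashDist (outputStateLaw ch q n) g := by
  rw [hashDist_outputStateLaw q g hf]
  have hdef : ch.errorProb (hashCode f q g hM) = ∑ w : Fin M, ∑ s : Fin n → S, ∑ x : Fin n → X,
      ∑ a : Fin n → Y₁, ∑ b : Fin n → Y₂, if g a = w then 0 else
      (1 / (M : ℝ)) * (∏ i, ch.state (s i)) * hashEnc f q g w s x *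
        ∏ i, ch.trans (x i) (s i) (a i, b i) := rfl
  rw [hdef]
  refine Finset.sum_le_sum fun w _ => Finset.sum_le_sum fun s _ => ?_
  have hPs := prod_state_nonneg ch s
  have e : ∀ (x : Fin n → X) (a : Fin n → Y₁) (b : Fin n → Y₂), (if g a = w then 0 else
      (1 / (M : ℝ)) * (∏ i, ch.state (s i)) * hashEnc f q g w s x *
        ∏ i, ch.trans (x i) (s i) (a i, b i)) =
      ((1 / (M : ℝ)) * (∏ i, ch.state (s i)) * hashEnc f q g w s x *
        if g (fun i => f (x i) (s i)) = w then 0 else 1) *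
          ∏ i, ch.trans (x i) (s i) (a i, b i) := by
    intro x a b
    have := hf.mul_prod_trans (fun a => if g a = w then 0 else 1) x s a b
    rw [mul_assoc _ (ite _ _ _), ← this]
    split_ifs <;> simp
  simp only [e, ← Finset.mul_sum, sum_prod_trans, mul_one]
  by_cases h : hashProb f q g w s = 0
  · rw [h, mul_zero, zero_sub, abs_neg]
    refine le_trans ?_ (le_abs_self _)
    calc _ ≤ ∑ x, (1 / (M : ℝ)) * (∏ i, ch.state (s i)) * hashEnc f q g w s x := by
          refine Finset.sum_le_sum fun x _ => ?_
          have : 0 ≤ (1 / (M : ℝ)) * (∏ i, ch.state (s i)) * hashEnc f q g w s x :=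
            mul_nonneg (mul_nonneg (by positivity) hPs) (stdSimplex.zero_le _ _)
          split_ifs
          · rwa [mul_zero]
          · rw [mul_one]
      _ = _ := by rw [← Finset.mul_sum, stdSimplex.sum_eq_one]; ring
  · refine le_trans (le_of_eq (Finset.sum_eq_zero fun x _ => ?_)) (abs_nonneg _)
    rw [hashEnc_apply_of_ne_zero f q g h]
    split_ifs <;> simp

/-- The code and the i.i.d. law use the same kernel `E` from `(w, s)` to `Y₂^n` and differ only in
the weights, `p(s)/M` against `p(s) * hashProb`. Their distance after `E` is at most the first
`hashDist`; the second takes the i.i.d. law to a product, and `mutualInfo_le` concludes. -/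
theorem leakage_hashCode_le (hM : 0 < M) :
    ch.leakage (hashCode f q g hM) ≤
      2 * (hashDist (outputStateLaw ch q n) g + hashDist (outputsLaw ch q n) g) *
        (Real.logb 2 M + 2) := by
  have hM' : (0 : ℝ) < M := by exact_mod_cast hM
  have hlM : 0 ≤ Real.logb 2 M := Real.logb_nonneg one_lt_two (by exact_mod_cast hM)
  set V : (Fin n → S) → (Fin n → X) → (Fin n → Y₂) → ℝ := fun s x b =>
    ∑ a : Fin n → Y₁, ∏ i, ch.trans (x i) (s i) (a i, b i) with hV
  have hV0 : ∀ s x b, 0 ≤ V s x b := fun s x b =>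
    Finset.sum_nonneg fun a _ => prod_trans_nonneg ch x s a b
  have hV1 : ∀ s x, ∑ b, V s x b = 1 := fun s x => by
    rw [← sum_prod_trans ch x s, Finset.sum_comm]
  set E : Fin M → (Fin n → S) → (Fin n → Y₂) → ℝ := fun w s b =>
    ∑ x, hashEnc f q g w s x * V s x b with hE
  have hE0 : ∀ w s b, 0 ≤ E w s b := fun w s b =>
    Finset.sum_nonneg fun x _ => mul_nonneg (stdSimplex.zero_le _ _) (hV0 s x b)
  have hE1 : ∀ w s, ∑ b, E w s b = 1 := fun w s => by
    simp only [hE]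
    rw [Finset.sum_comm]
    simp only [← Finset.mul_sum, hV1, mul_one, stdSimplex.sum_eq_one]
  set L : Fin M × (Fin n → Y₂) → ℝ := fun p => ∑ s : Fin n → S, ∑ x : Fin n → X,
    ∑ a : Fin n → Y₁, (1 / (M : ℝ)) * (∏ i, ch.state (s i)) * hashEnc f q g p.1 s x *
      ∏ i, ch.trans (x i) (s i) (a i, p.2 i)
  have hdef : ch.leakage (hashCode f q g hM) = mutualInfo L := rfl
  rw [hdef]
  have hL : ∀ w b, L (w, b) =
      ∑ s : Fin n → S, (∏ i, ch.state (s i)) / M * E w s b := by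
    intro w b
    refine Finset.sum_congr rfl fun s _ => ?_
    simp only [hE, hV, Finset.mul_sum]
    refine Finset.sum_congr rfl fun x _ => Finset.sum_congr rfl fun a _ => ?_
    ring
  have hI : ∀ w b, (∑ a, if g a = w then outputsLaw ch q n a b else 0) =
      ∑ s : Fin n → S, (∏ i, ch.state (s i)) * hashProb f q g w s * E w s b := by
    intro w b
    have e1 : ∀ a, (if g a = w then outputsLaw ch q n a b else 0) =
        ∑ s : Fin n → S, ∑ x, (∏ i, ch.state (s i)) * hashProb f q g w s *
          (hashEnc f q g w s x * ∏ i, ch.trans (x i) (s i) (a i, b i)) := by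
      intro a
      have e2 : (if g a = w then outputsLaw ch q n a b else 0) =
          (if g a = w then 1 else 0) * outputsLaw ch q n a b := by split_ifs <;> simp
      rw [e2, outputsLaw, prod_law_outputs, Finset.mul_sum]
      refine Finset.sum_congr rfl fun s _ => ?_
      rw [Finset.mul_sum]
      refine Finset.sum_congr rfl fun x _ => ?_
      have h1 := hf.mul_prod_trans (fun a => if g a = w then (1 : ℝ) else 0) x s a b
      have h2 := hashProb_mul_hashEnc f q g w s x
      have h3 : (if g (fun i => f (x i) (s i)) = w then ∏ i, q (s i) (x i) else 0) =
          (∏ i, q (s i) (x i)) * if g (fun i => f (x i) (s i)) = w then 1 else 0 := by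
        split_ifs <;> simp
      rw [h3] at h2
      linear_combination (∏ i, ch.state (s i)) * (∏ i, q (s i) (x i)) * h1 -
        (∏ i, ch.state (s i)) * (∏ i, ch.trans (x i) (s i) (a i, b i)) * h2
    simp only [e1]
    rw [Finset.sum_comm]
    refine Finset.sum_congr rfl fun s _ => ?_
    rw [Finset.sum_comm]
    simp only [hE, hV, Finset.mul_sum]
  have key := mutualInfo_le M hM L
    (fun ⟨w, b⟩ => by
      rw [hL]
      exact Finset.sum_nonneg fun s _ => mul_nonneg
        (div_nonneg (prod_state_nonneg ch s) hM'.le) (hE0 _ _ _))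
    (fun w => by
      simp only [hL]
      rw [Finset.sum_comm]
      simp only [← Finset.mul_sum, hE1, mul_one, ← Finset.sum_div, sum_prod_state])
    (fun b => ∑ a, outputsLaw ch q n a b)
  refine key.trans (mul_le_mul_of_nonneg_right
    (mul_le_mul_of_nonneg_left ?_ two_pos.le) (by linarith))
  have htri : ∀ w b, |L (w, b) -
      (∑ a, outputsLaw ch q n a b) / M| ≤
      (∑ s : Fin n → S, |(∏ i, ch.state (s i)) * hashProb f q g w s -
        (∏ i, ch.state (s i)) / M| * E w s b) +
      |(∑ a, if g a = w then outputsLaw ch q n a b else 0) -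
        (∑ a, outputsLaw ch q n a b) / M| := by
    intro w b
    refine (abs_sub_le _ (∑ a, if g a = w then outputsLaw ch q n a b else 0) _).trans
      (add_le_add ?_ le_rfl)
    rw [hL, hI, ← Finset.sum_sub_distrib]
    refine (Finset.abs_sum_le_sum_abs _ _).trans (Finset.sum_le_sum fun s _ => ?_)
    rw [← sub_mul, abs_mul, abs_of_nonneg (hE0 w s b), abs_sub_comm]
  refine (Finset.sum_le_sum fun w _ => Finset.sum_le_sum fun b _ => htri w b).trans
    (le_of_eq ?_)
  simp only [Finset.sum_add_distrib]
  rw [hashDist_outputStateLaw q g hf]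
  congr 1
  refine Finset.sum_congr rfl fun w _ => ?_
  rw [Finset.sum_comm]
  simp only [← Finset.mul_sum, hE1, mul_one]

end HashCode

end Channel

/-- Diagonal choice: if some element of each `C n` is eventually arbitrarily good, then one
sequence of elements becomes arbitrarily good. -/
theorem exists_tendsto_zero_of_eventually_exists_le {C : ℕ → Type*} [∀ n, Nonempty (C n)]
    (bad : ∀ n, C n → ℝ) (h0 : ∀ n c, 0 ≤ bad n c)
    (h : ∀ ε > 0, ∀ᶠ n in atTop, ∃ c, bad n c ≤ ε) :
    ∃ c : ∀ n, C n, Tendsto (fun n => bad n (c n)) atTop (𝓝 0) := by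
  -- Near-minimizers do not depend on the tolerance, so one sequence beats every `ε`; the infimum
  -- need not be attained.
  have hex : ∀ n, ∃ c : C n, bad n c < (⨅ c, bad n c) + 1 / ((n : ℝ) + 1) := fun n =>
    exists_lt_of_ciInf_lt (lt_add_of_pos_right _ (by positivity))
  choose c hc using hex
  refine ⟨c, ?_⟩
  rw [Metric.tendsto_atTop']
  intro ε hε
  have h1 : ∀ᶠ n : ℕ in atTop, 1 / ((n : ℝ) + 1) < ε / 2 :=
    tendsto_one_div_add_atTop_nhds_zero_nat.eventually_lt_const (half_pos hε)
  obtain ⟨N, hN⟩ := eventually_atTop.1 ((h (ε / 2) (half_pos hε)).and h1)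
  refine ⟨N, fun n hn => ?_⟩
  obtain ⟨⟨d, hd⟩, hn1⟩ := hN n hn.le
  have hinf : (⨅ c, bad n c) ≤ bad n d := ciInf_le ⟨0, by rintro _ ⟨c, rfl⟩; exact h0 n c⟩ d
  rw [Real.dist_eq, sub_zero, abs_of_nonneg (h0 _ _)]
  linarith [hc n]

/-! ### Achievability. -/

namespace Channel

variable {X S Y₁ Y₂ : Type*} [Fintype X] [Fintype S] [Fintype Y₁] [Fintype Y₂]
  (ch : Channel X S Y₁ Y₂)

theorem singleLaw_nonneg (q : S → stdSimplex ℝ X) (s : S) (x : X) (a : Y₁) (b : Y₂) :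
    0 ≤ ch.singleLaw q s x a b :=
  mul_nonneg (mul_nonneg (stdSimplex.zero_le _ _) (stdSimplex.zero_le _ _))
    (stdSimplex.zero_le _ _)

theorem sum_singleLaw (q : S → stdSimplex ℝ X) :
    ∑ s, ∑ x, ∑ a, ∑ b, ch.singleLaw q s x a b = 1 := by
  have : ∀ s x, ∑ a, ∑ b, ch.trans x s (a, b) = 1 := fun s x => by
    rw [← Fintype.sum_prod_type]; exact stdSimplex.sum_eq_one _
  simp only [singleLaw, ← Finset.mul_sum, this, mul_one, stdSimplex.sum_eq_one]

theorem sum_outputStateLaw (q : S → stdSimplex ℝ X) :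
    ∑ z : Y₁ × S, ∑ x, ∑ b, ch.singleLaw q z.2 x z.1 b = 1 := by
  rw [Fintype.sum_prod_type, Finset.sum_comm, ← ch.sum_singleLaw q]
  exact Finset.sum_congr rfl fun s _ => Finset.sum_comm

theorem sum_outputsLaw (q : S → stdSimplex ℝ X) :
    ∑ z : Y₁ × Y₂, ∑ s, ∑ x, ch.singleLaw q s x z.1 z.2 = 1 := by
  rw [← ch.sum_singleLaw q, Finset.sum_comm]
  refine Finset.sum_congr rfl fun s _ => ?_
  rw [Finset.sum_comm]
  exact Finset.sum_congr rfl fun x _ => Fintype.sum_prod_type _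

section Code

variable {n : ℕ} (c : Code X S Y₁ n)

theorem blockLaw_nonneg (w : Fin c.M) (s : Fin n → S) (x : Fin n → X) (a : Fin n → Y₁)
    (b : Fin n → Y₂) : 0 ≤ ch.blockLaw c w s x a b :=
  mul_nonneg (mul_nonneg (mul_nonneg (by positivity) (prod_state_nonneg ch s))
    (stdSimplex.zero_le _ _)) (prod_trans_nonneg ch x s a b)

theorem sum_blockLaw_of_message_state (w : Fin c.M) (s : Fin n → S) :
    ∑ x, ∑ a, ∑ b, ch.blockLaw c w s x a b = 1 / (c.M : ℝ) * ∏ i, ch.state (s i) := by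
  simp only [blockLaw, ← Finset.mul_sum, sum_prod_trans, mul_one, stdSimplex.sum_eq_one]

theorem sum_blockLaw_of_message (w : Fin c.M) :
    ∑ s, ∑ x, ∑ a, ∑ b, ch.blockLaw c w s x a b = 1 / (c.M : ℝ) := by
  simp only [sum_blockLaw_of_message_state, ← Finset.mul_sum, sum_prod_state, mul_one]

theorem errorProb_nonneg : 0 ≤ ch.errorProb c :=
  Finset.sum_nonneg fun w _ => Finset.sum_nonneg fun s _ => Finset.sum_nonneg fun x _ =>
    Finset.sum_nonneg fun a _ => Finset.sum_nonneg fun b _ => by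
      split_ifs
      exacts [le_rfl, ch.blockLaw_nonneg c w s x a b]

theorem leakage_nonneg : 0 ≤ ch.leakage c := by
  refine mutualInfo_nonneg _ (fun z => Finset.sum_nonneg fun s _ => Finset.sum_nonneg fun x _ =>
    Finset.sum_nonneg fun a _ => ch.blockLaw_nonneg c _ s x a _) ?_
  have h : ∀ w : Fin c.M, ∑ b, ∑ s, ∑ x, ∑ a, ch.blockLaw c w s x a b = 1 / (c.M : ℝ) := by
    intro w
    rw [← ch.sum_blockLaw_of_message c w, Finset.sum_comm]
    refine Finset.sum_congr rfl fun s _ => ?_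
    rw [Finset.sum_comm]
    exact Finset.sum_congr rfl fun x _ => Finset.sum_comm
  have hM : (c.M : ℝ) ≠ 0 := by exact_mod_cast c.M_pos.ne'
  simp only [h]
  simp [hM]

end Code

variable {ch} [Nonempty X] {f : X → S → Y₁}

/-- Secrecy is measured per channel use and `(log M + 2) / n` stays bounded, so it suffices that the
hash distances become small, at any speed. -/
theorem IsSemiDeterministic.eventually_exists_code (hf : ch.IsSemiDeterministic f)
    (q : S → stdSimplex ℝ X) {R : ℝ} (hR₁ : R ≤ ch.entropyGivenState q)
    (hR₂ : R ≤ ch.entropyGivenEve q) {ε : ℝ} (hε : 0 < ε) :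
    ∀ᶠ n : ℕ in atTop, ∃ c : Code X S Y₁ n,
      R - ε ≤ c.rate ∧ ch.errorProb c ≤ ε ∧ ch.leakage c / n ≤ ε := by
  -- A target rate that is not positive is met by a single message, whose hash distances are zero.
  rcases le_or_gt R ε with hRε | hRε
  · refine Eventually.of_forall fun n => ?_
    have he := errorProb_hashCode_le q (fun _ : Fin n → Y₁ => (0 : Fin 1)) hf one_pos
    have hl := leakage_hashCode_le q (fun _ : Fin n → Y₁ => (0 : Fin 1)) hf one_pos
    rw [hashDist_one] at he
    rw [hashDist_one, hashDist_one, add_zero, mul_zero, zero_mul] at hl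
    refine ⟨_, ?_, he.trans hε.le, (div_nonpos_of_nonpos_of_nonneg hl n.cast_nonneg).trans hε.le⟩
    have : (hashCode f q (fun _ : Fin n → Y₁ => (0 : Fin 1)) one_pos).rate = 0 := by
      change Real.logb 2 ((1 : ℕ) : ℝ) / n = 0
      simp
    rw [this]; linarith
  · have hR0 : 0 < R := hε.trans hRε
    -- Two distances of average at most `δ` give leakage at most `4 δ (log M + 2)`, and `log M + 2 ≤
    -- n (R + 3)`.
    have hδ : 0 < ε / (4 * (R + 3)) := by positivity
    filter_upwards [eventually_sum_hashDist_le _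
        (fun _ => Finset.sum_nonneg fun x _ => Finset.sum_nonneg fun b _ =>
          ch.singleLaw_nonneg q _ x _ b) (ch.sum_outputStateLaw q) hε hδ hR₁,
      eventually_sum_hashDist_le _
        (fun _ => Finset.sum_nonneg fun s _ => Finset.sum_nonneg fun x _ =>
          ch.singleLaw_nonneg q s x _ _) (ch.sum_outputsLaw q) hε hδ hR₂,
      eventually_gt_atTop 0] with n h₁ h₂ hn
    have hn' : (1 : ℝ) ≤ n := by exact_mod_cast hn
    have hexp : 0 ≤ (n : ℝ) * (R - ε) := mul_nonneg (by linarith) (by linarith)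
    have hpow : (1 : ℝ) ≤ 2 ^ ((n : ℝ) * (R - ε)) := Real.one_le_rpow one_le_two hexp
    obtain ⟨M, hMdef⟩ : ∃ M, M = ⌈(2 : ℝ) ^ ((n : ℝ) * (R - ε))⌉₊ := ⟨_, rfl⟩
    have hMge : (2 : ℝ) ^ ((n : ℝ) * (R - ε)) ≤ M := hMdef ▸ Nat.le_ceil _
    have hMle : (M : ℝ) ≤ 2 * 2 ^ ((n : ℝ) * (R - ε)) := by
      have := Nat.ceil_lt_add_one (by positivity : (0 : ℝ) ≤ 2 ^ ((n : ℝ) * (R - ε)))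
      rw [← hMdef] at this
      linarith
    have hM' : (0 : ℝ) < M := by linarith
    have hM : 0 < M := by exact_mod_cast hM'
    obtain ⟨g, hg⟩ := exists_hashDist_add_le (outputStateLaw ch q n) (outputsLaw ch q n) hM
      (h₁ M hM hMle) (h₂ M hM hMle)
    have hd₁ := hashDist_nonneg (outputStateLaw ch q n) g
    have hd₂ := hashDist_nonneg (outputsLaw ch q n) g
    have hlogle : Real.logb 2 M ≤ 1 + n * (R - ε) := by
      rw [Real.logb_le_iff_le_rpow one_lt_two hM', Real.rpow_add two_pos, Real.rpow_one]
      exact hMle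
    have hlogge : n * (R - ε) ≤ Real.logb 2 M := by
      rwa [Real.le_logb_iff_rpow_le one_lt_two hM']
    have hd : ε / (4 * (R + 3)) + ε / (4 * (R + 3)) ≤ ε := by
      rw [← add_div, div_le_iff₀ (by positivity)]
      nlinarith
    refine ⟨hashCode f q g hM, ?_, ?_, ?_⟩
    · change R - ε ≤ Real.logb 2 (M : ℝ) / n
      rw [le_div_iff₀ (by linarith)]; linarith
    · exact (errorProb_hashCode_le q g hf hM).trans (by linarith)
    · rw [div_le_iff₀ (by linarith)]
      refine (leakage_hashCode_le q g hf hM).trans ?_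
      have h0 : 0 ≤ Real.logb 2 M + 2 := by linarith
      have h3 : Real.logb 2 M + 2 ≤ n * (R + 3) := by nlinarith
      calc _ ≤ 2 * (ε / (4 * (R + 3)) + ε / (4 * (R + 3))) * (n * (R + 3)) := by
            gcongr
        _ = ε * n := by field_simp; ring

/-- The rate `min (H(Y₁|S)) (H(Y₁|Y₂))` is achievable for every input law. -/
theorem IsSemiDeterministic.achievable (hf : ch.IsSemiDeterministic f)
    (q : S → stdSimplex ℝ X) :
    ch.Achievable (min (ch.entropyGivenState q) (ch.entropyGivenEve q)) := by
  set R := min (ch.entropyGivenState q) (ch.entropyGivenEve q)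
  have hne : ∀ n, Nonempty (Code X S Y₁ n) := fun n =>
    ⟨hashCode f q (fun _ : Fin n → Y₁ => (0 : Fin 1)) one_pos⟩
  -- The three requirements are merged into one defect, nonnegative because the error probability
  -- is.
  obtain ⟨c, hc⟩ := exists_tendsto_zero_of_eventually_exists_le
    (fun n (c : Code X S Y₁ n) => max (R - c.rate) (max (ch.errorProb c) (ch.leakage c / n)))
    (fun n c => le_max_of_le_right (le_max_of_le_left (ch.errorProb_nonneg c))) (by
      intro ε hε
      filter_upwards [hf.eventually_exists_code q (min_le_left _ _) (min_le_right _ _) hε]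
        with n ⟨c, h1, h2, h3⟩
      exact ⟨c, max_le (by linarith) (max_le h2 h3)⟩)
  refine ⟨c, fun ε hε => ?_, ?_, ?_⟩
  · filter_upwards [hc.eventually_lt_const hε] with n hn
    have := (le_max_left _ _).trans hn.le
    linarith
  · exact squeeze_zero (fun n => ch.errorProb_nonneg (c n))
      (fun n => (le_max_left _ _).trans (le_max_right _ _)) hc
  · exact squeeze_zero (fun n => div_nonneg (ch.leakage_nonneg (c n)) n.cast_nonneg)
      (fun n => (le_max_right _ _).trans (le_max_right _ _)) hc

end Channel

/-! ### Fano's inequality, single-letter bounds and continuity of conditional entropy. -/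

section Converse

theorem mutualInfo_mul {α β : Type*} [Fintype α] [Fintype β] (u : α → ℝ) (v : β → ℝ)
    (hu : ∑ a, u a = 1) (hv : ∑ b, v b = 1) : mutualInfo (fun z : α × β => u z.1 * v z.2) = 0 := by
  unfold mutualInfo
  refine Finset.sum_eq_zero fun a _ => Finset.sum_eq_zero fun b _ => ?_
  simp only [← Finset.mul_sum, ← Finset.sum_mul, hu, hv, mul_one, one_mul]
  rcases eq_or_ne (u a * v b) 0 with h | h
  · rw [h, zero_mul]
  · rw [div_self h, Real.logb_one, mul_zero]

/-- Fano's inequality for a uniform message `W`, an observation `B` and a decoder that sees `A`: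
`log M ≤ I(W; B) + H(A | B) + 1 + Pₑ log M`. -/
theorem logb_card_le {A B : Type*} [Fintype A] [Fintype B] {M : ℕ} (hM : 0 < M)
    (p : Fin M → A → B → ℝ) (hp : ∀ w a b, 0 ≤ p w a b)
    (hunif : ∀ w, ∑ a, ∑ b, p w a b = 1 / M) (dec : A → Fin M) :
    Real.logb 2 M ≤ mutualInfo (fun z : Fin M × B => ∑ a, p z.1 a z.2) +
      condEntropy (fun z : A × B => ∑ w, p w z.1 z.2) + 1 +
      (∑ w, ∑ a, ∑ b, if dec a = w then 0 else p w a b) * Real.logb 2 M := by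
  have hM' : (0 : ℝ) < M := by exact_mod_cast hM
  have hl : 0 < Real.log 2 := Real.log_pos one_lt_two
  -- A guess of `W` from `A`: half the mass on the decoded message, half spread uniformly, the
  -- overlap dropped. Its code length is 1 bit if decoding is right and `1 + log M` if wrong.
  set r : Fin M → A → ℝ := fun w a => if dec a = w then 1 / 2 else 1 / (2 * M) with hr
  have hrpos : ∀ w a, 0 < r w a := fun w a => by simp only [hr]; split_ifs <;> positivity
  have hr1 : ∀ a, ∑ w, r w a ≤ 1 := by
    intro a
    have h : ∀ w, r w a ≤ (if dec a = w then 1 / 2 else 0) + 1 / (2 * M) := by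
      intro w
      simp only [hr]
      split_ifs
      · exact le_add_of_nonneg_right (by positivity)
      · rw [zero_add]
    refine (Finset.sum_le_sum fun w _ => h w).trans (le_of_eq ?_)
    rw [Finset.sum_add_distrib]
    simp
    field_simp
    norm_num
  have hWB : ∀ w a b, p w a b ≤ ∑ a, p w a b := fun w a b =>
    Finset.single_le_sum (f := fun a => p w a b) (fun _ _ => hp _ _ _) (Finset.mem_univ a)
  have hAB : ∀ w a b, p w a b ≤ ∑ w, p w a b := fun w a b =>
    Finset.single_le_sum (f := fun w => p w a b) (fun _ _ => hp _ _ _) (Finset.mem_univ w)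
  -- Termwise form of `log M = I(W;B) + H(W|B)` and `H(W|B) ≤ H(A|B) + H(W|A,B)`, with `H(W|A,B)`
  -- bounded by comparison with `r`.
  have hterm : ∀ w a b, p w a b * Real.logb 2 M ≤
      p w a b * Real.logb 2 ((∑ a, p w a b) / (1 / M * ∑ w', ∑ a, p w' a b)) -
      p w a b * Real.logb 2 ((∑ w, p w a b) / ∑ a, ∑ w, p w a b) + p w a b +
      (if dec a = w then 0 else p w a b) * Real.logb 2 M +
      ((∑ w, p w a b) * r w a - p w a b) / Real.log 2 := by
    intro w a b
    rw [Finset.sum_comm (s := (Finset.univ : Finset A))]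
    set P := p w a b
    set PW := ∑ a, p w a b
    set PA := ∑ w, p w a b
    set PB := ∑ w', ∑ a, p w' a b
    have hP : 0 ≤ P := hp w a b
    have hPW : P ≤ PW := hWB w a b
    have hPA : P ≤ PA := hAB w a b
    have hPB : PW ≤ PB := Finset.single_le_sum (f := fun w => ∑ a, p w a b)
      (fun _ _ => Finset.sum_nonneg fun _ _ => hp _ _ _) (Finset.mem_univ w)
    have hg := mul_logb_div_le hP (mul_nonneg (hP.trans hPA) (hrpos w a).le)
      (fun h => mul_pos (h.trans_le hPA) (hrpos w a))
    rcases hP.eq_or_lt with h0 | h0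
    · simp only [← h0, zero_mul, ite_self, sub_zero, add_zero, zero_add]
      exact div_nonneg (mul_nonneg (hP.trans hPA) (hrpos w a).le) hl.le
    have hW0 : 0 < PW := h0.trans_le hPW
    have hA0 : 0 < PA := h0.trans_le hPA
    have hB0 : 0 < PB := hW0.trans_le hPB
    have e1 : Real.logb 2 (PW / (1 / M * PB)) =
        Real.logb 2 PW + Real.logb 2 M - Real.logb 2 PB := by
      rw [Real.logb_div hW0.ne' (by positivity), Real.logb_mul (by positivity) hB0.ne', one_div,
        Real.logb_inv]
      ring
    have e2 : Real.logb 2 (PA / PB) = Real.logb 2 PA - Real.logb 2 PB :=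
      Real.logb_div hA0.ne' hB0.ne'
    have e3 : Real.logb 2 (PA * r w a / P) =
        Real.logb 2 PA + Real.logb 2 (r w a) - Real.logb 2 P := by
      rw [Real.logb_div (mul_pos hA0 (hrpos w a)).ne' h0.ne',
        Real.logb_mul hA0.ne' (hrpos w a).ne']
    have e4 : P * Real.logb 2 (r w a) = -P - (if dec a = w then 0 else P) * Real.logb 2 M := by
      simp only [hr]
      split_ifs
      · rw [one_div, Real.logb_inv, Real.logb_self_eq_one one_lt_two]; ring
      · rw [one_div, Real.logb_inv, Real.logb_mul two_ne_zero hM'.ne',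
          Real.logb_self_eq_one one_lt_two]; ring
    -- The termwise content of `H(A|W,B) ≥ 0`.
    have h5 : P * Real.logb 2 P ≤ P * Real.logb 2 PW :=
      mul_le_mul_of_nonneg_left (Real.logb_le_logb_of_le one_lt_two h0 hPW) hP
    rw [e3] at hg
    rw [e1, e2]
    nlinarith
  have hsum := Finset.sum_le_sum fun w (_ : w ∈ Finset.univ) =>
    Finset.sum_le_sum fun a (_ : a ∈ Finset.univ) =>
      Finset.sum_le_sum fun b (_ : b ∈ Finset.univ) => hterm w a b
  have htot : ∑ w : Fin M, ∑ a, ∑ b, p w a b = 1 := by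
    simp only [hunif]; simp; field_simp
  simp only [Finset.sum_add_distrib, Finset.sum_sub_distrib, ← Finset.sum_mul, htot, one_mul,
    ← Finset.sum_div] at hsum
  have hmass : ∑ w, ∑ a, (∑ b, ∑ w', p w' a b) * r w a ≤ 1 := by
    rw [Finset.sum_comm]
    simp only [← Finset.mul_sum]
    calc _ ≤ ∑ a, (∑ b, ∑ w', p w' a b) * 1 := Finset.sum_le_sum fun a _ =>
          mul_le_mul_of_nonneg_left (hr1 a)
            (Finset.sum_nonneg fun _ _ => Finset.sum_nonneg fun _ _ => hp _ _ _)
      _ = 1 := by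
          simp only [mul_one]
          rw [← htot, Finset.sum_comm (s := (Finset.univ : Finset (Fin M)))]
          exact Finset.sum_congr rfl fun a _ => Finset.sum_comm
  have hmi : mutualInfo (fun z : Fin M × B => ∑ a, p z.1 a z.2) =
      ∑ w, ∑ a, ∑ b, p w a b *
        Real.logb 2 ((∑ a, p w a b) / (1 / M * ∑ w', ∑ a, p w' a b)) := by
    unfold mutualInfo
    refine Finset.sum_congr rfl fun w _ => ?_
    rw [Finset.sum_comm (s := (Finset.univ : Finset A))]
    refine Finset.sum_congr rfl fun b _ => ?_
    rw [← Finset.sum_mul]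
    have : ∑ b', ∑ a, p w a b' = 1 / M := by rw [Finset.sum_comm, hunif]
    simp only [this]
  have hce : condEntropy (fun z : A × B => ∑ w, p w z.1 z.2) =
      -∑ w, ∑ a, ∑ b, p w a b * Real.logb 2 ((∑ w, p w a b) / ∑ a, ∑ w, p w a b) := by
    unfold condEntropy
    rw [Finset.sum_comm (s := (Finset.univ : Finset (Fin M)))]
    congr 1
    refine Finset.sum_congr rfl fun a _ => ?_
    rw [Finset.sum_comm]
    refine Finset.sum_congr rfl fun b _ => ?_
    rw [← Finset.sum_mul]
  rw [hmi, hce]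
  have h6 : (∑ w, ∑ a, (∑ b, ∑ w', p w' a b) * r w a - 1) / Real.log 2 ≤ 0 :=
    div_nonpos_of_nonpos_of_nonneg (by linarith) hl.le
  linarith

/-- The conditional entropy of a block is at most `n` times the conditional entropy of the
time-averaged law of one letter. -/
theorem condEntropy_block_le {A B : Type*} [Fintype A] [Fintype B] {n : ℕ}
    (P : (Fin n → A) × (Fin n → B) → ℝ) (hP : ∀ z, 0 ≤ P z) (p : A × B → ℝ) (hp : ∀ z, 0 ≤ p z)
    (h : ∀ φ : A → B → ℝ, ∑ a, ∑ b, P (a, b) * ∑ i, φ (a i) (b i) =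
      n * ∑ a, ∑ b, p (a, b) * φ a b) :
    condEntropy P ≤ n * condEntropy p := by
  classical
  have hl : 0 < Real.log 2 := Real.log_pos one_lt_two
  -- The block law is compared with `P(b) ∏ k(a_i, b_i)`; `h` applied to `log k` then produces the
  -- single-letter entropy. Where the marginal is zero, `k` is zero, hence only `∑ k ≤ 1`.
  set k : A → B → ℝ := fun a b => p (a, b) / ∑ a', p (a', b) with hk
  have hk0 : ∀ a b, 0 ≤ k a b := fun a b =>
    div_nonneg (hp _) (Finset.sum_nonneg fun _ _ => hp _)
  have hk1 : ∀ b, ∑ a, k a b ≤ 1 := fun b => by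
    simp only [hk, ← Finset.sum_div]
    exact div_self_le_one _
  -- Absolute continuity, by testing `h` on the indicator of the letter pair `(a i, b i)`.
  have hac : ∀ a b, 0 < P (a, b) → ∀ i, 0 < k (a i) (b i) := by
    intro a b hab i
    have hne : p (a i, b i) ≠ 0 := by
      intro h0
      have h1 := h fun a' b' => if a' = a i ∧ b' = b i then 1 else 0
      have h2 : ∑ a', ∑ b', p (a', b') * (if a' = a i ∧ b' = b i then 1 else 0) = 0 :=
        Finset.sum_eq_zero fun a' _ => Finset.sum_eq_zero fun b' _ => by
          split_ifs with hh
          · rw [hh.1, hh.2, h0, zero_mul]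
          · rw [mul_zero]
      rw [h2, mul_zero] at h1
      have hn : ∀ (a' : Fin n → A) (b' : Fin n → B), 0 ≤ P (a', b') *
          ∑ j, if a' j = a i ∧ b' j = b i then (1 : ℝ) else 0 := fun a' b' =>
        mul_nonneg (hP _) (Finset.sum_nonneg fun j _ => by split_ifs <;> norm_num)
      have h3 := (Finset.sum_eq_zero_iff_of_nonneg
        fun a' _ => Finset.sum_nonneg fun b' _ => hn a' b').1 h1 a (Finset.mem_univ a)
      have h4 := (Finset.sum_eq_zero_iff_of_nonneg fun b' _ => hn a b').1 h3 b (Finset.mem_univ b)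
      have h5 : (1 : ℝ) ≤ ∑ j, if a j = a i ∧ b j = b i then (1 : ℝ) else 0 := by
        have := Finset.single_le_sum (f := fun j => if a j = a i ∧ b j = b i then (1 : ℝ) else 0)
          (fun j _ => by split_ifs <;> norm_num) (Finset.mem_univ i)
        simpa using this
      nlinarith
    have hpos := (hp (a i, b i)).lt_of_ne' hne
    exact div_pos hpos (hpos.trans_le
      (Finset.single_le_sum (f := fun a' => p (a', b i)) (fun _ _ => hp _) (Finset.mem_univ (a i))))
  have hm : ∀ a b, P (a, b) ≤ ∑ a', P (a', b) := fun a b =>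
    Finset.single_le_sum (f := fun a => P (a, b)) (fun _ _ => hP _) (Finset.mem_univ a)
  have hterm : ∀ a b, -(P (a, b) * Real.logb 2 (P (a, b) / ∑ a', P (a', b))) +
      P (a, b) * ∑ i, Real.logb 2 (k (a i) (b i)) ≤
      ((∑ a', P (a', b)) * (∏ i, k (a i) (b i)) - P (a, b)) / Real.log 2 := by
    intro a b
    have hg := mul_logb_div_le (q := (∑ a', P (a', b)) * ∏ i, k (a i) (b i)) (hP (a, b))
      (mul_nonneg ((hP (a, b)).trans (hm a b))
      (Finset.prod_nonneg fun i _ => hk0 (a i) (b i)))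
      (fun h => mul_pos (h.trans_le (hm a b)) (Finset.prod_pos fun i _ => hac a b h i))
    refine le_trans (le_of_eq ?_) hg
    rcases (hP (a, b)).eq_or_lt with h0 | h0
    · simp [← h0]
    · have hB := h0.trans_le (hm a b)
      rw [← Real.logb_prod _ _ fun i _ => (hac a b h0 i).ne', Real.logb_div h0.ne' hB.ne',
        Real.logb_div (mul_pos hB (Finset.prod_pos fun i _ => hac a b h0 i)).ne' h0.ne',
        Real.logb_mul hB.ne' (Finset.prod_pos fun i _ => hac a b h0 i).ne']
      ring
  have hsum := Finset.sum_le_sum fun a (_ : a ∈ Finset.univ) =>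
    Finset.sum_le_sum fun b (_ : b ∈ Finset.univ) => hterm a b
  simp only [Finset.sum_add_distrib, Finset.sum_sub_distrib, ← Finset.sum_div,
    Finset.sum_neg_distrib] at hsum
  rw [h fun a b => Real.logb 2 (k a b)] at hsum
  have hmass : ∑ a : Fin n → A, ∑ b, (∑ a', P (a', b)) * (∏ i, k (a i) (b i)) ≤
      ∑ a, ∑ b, P (a, b) := by
    rw [Finset.sum_comm, Finset.sum_comm (f := fun a b => P (a, b))]
    refine Finset.sum_le_sum fun b _ => ?_
    rw [← Finset.mul_sum, ← Fintype.prod_sum fun i a => k a (b i)]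
    exact mul_le_of_le_one_right (Finset.sum_nonneg fun _ _ => hP _)
      (Finset.prod_le_one (fun i _ => Finset.sum_nonneg fun _ _ => hk0 _ _) fun i _ => hk1 _)
  have h6 := div_nonpos_of_nonpos_of_nonneg (sub_nonpos.2 hmass) hl.le
  unfold condEntropy
  linarith

/-- The form `H(A,B) - H(B)` avoids quotients, so continuity persists where probabilities vanish. -/
theorem condEntropy_eq {α β : Type*} [Fintype α] [Fintype β] (p : α × β → ℝ)
    (hp : ∀ z, 0 ≤ p z) : condEntropy p =
      (∑ a, ∑ b, Real.negMulLog (p (a, b)) - ∑ b, Real.negMulLog (∑ a, p (a, b))) /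
        Real.log 2 := by
  have e : ∀ a b, p (a, b) * Real.logb 2 (p (a, b) / ∑ a', p (a', b)) =
      -((Real.negMulLog (p (a, b)) + p (a, b) * Real.log (∑ a', p (a', b))) / Real.log 2) := by
    intro a b
    rcases (hp (a, b)).eq_or_lt with h | h
    · simp [← h]
    · have hB := h.trans_le (Finset.single_le_sum (f := fun a' => p (a', b))
        (fun _ _ => hp _) (Finset.mem_univ a))
      rw [Real.logb, Real.log_div h.ne' hB.ne', Real.negMulLog]
      ring
  simp only [condEntropy, e, Finset.sum_neg_distrib, neg_neg, ← Finset.sum_div,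
    Finset.sum_add_distrib]
  congr 1
  rw [Finset.sum_comm (f := fun a b => p (a, b) * Real.log (∑ a', p (a', b)))]
  simp only [← Finset.sum_mul, Real.negMulLog, neg_mul, Finset.sum_neg_distrib, sub_neg_eq_add]

theorem continuous_condEntropy {α β T : Type*} [Fintype α] [Fintype β] [TopologicalSpace T]
    (p : T → α × β → ℝ) (hp : ∀ t z, 0 ≤ p t z) (hc : ∀ z, Continuous fun t => p t z) :
    Continuous fun t => condEntropy (p t) := by
  simp only [condEntropy_eq _ (hp _)]
  refine (Continuous.sub ?_ ?_).div_const _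
  · exact continuous_finsetSum _ fun a _ => continuous_finsetSum _ fun b _ =>
      Real.continuous_negMulLog.comp (hc _)
  · exact continuous_finsetSum _ fun b _ => Real.continuous_negMulLog.comp
      (continuous_finsetSum _ fun a _ => hc _)

end Converse

/-! ### Interchanges of finite sums. -/

section Reordering

variable {W S X A B : Type*} [Fintype W] [Fintype S] [Fintype X] [Fintype A] [Fintype B]

theorem sum_output_state_reorder (F : S → X → A → B → ℝ) :
    ∑ a, ∑ s, ∑ x, ∑ b, F s x a b = ∑ s, ∑ x, ∑ a, ∑ b, F s x a b := by
  rw [Finset.sum_comm]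
  exact Finset.sum_congr rfl fun s _ => Finset.sum_comm

theorem sum_outputs_reorder (F : S → X → A → B → ℝ) :
    ∑ a, ∑ b, ∑ s, ∑ x, F s x a b = ∑ s, ∑ x, ∑ a, ∑ b, F s x a b := by
  rw [← sum_output_state_reorder F]
  refine Finset.sum_congr rfl fun a _ => ?_
  rw [Finset.sum_comm]
  exact Finset.sum_congr rfl fun s _ => Finset.sum_comm

theorem sum_output_state_message_reorder (F : W → S → X → A → B → ℝ) :
    ∑ a, ∑ s, ∑ w, ∑ x, ∑ b, F w s x a b = ∑ w, ∑ s, ∑ x, ∑ a, ∑ b, F w s x a b := by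
  simp only [← sum_output_state_reorder (F _)]
  rw [Finset.sum_comm (s := (Finset.univ : Finset W))]
  exact Finset.sum_congr rfl fun a _ => Finset.sum_comm

theorem sum_outputs_message_reorder (F : W → S → X → A → B → ℝ) :
    ∑ a, ∑ b, ∑ w, ∑ s, ∑ x, F w s x a b = ∑ w, ∑ s, ∑ x, ∑ a, ∑ b, F w s x a b := by
  simp only [← sum_outputs_reorder (F _)]
  rw [Finset.sum_comm (s := (Finset.univ : Finset W))]
  exact Finset.sum_congr rfl fun a _ => Finset.sum_comm

end Reordering

/-! ### Time averaging and the converse for codes. -/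

namespace Channel

variable {X S Y₁ Y₂ : Type*} [Fintype X] [Fintype S] [Fintype Y₁] [Fintype Y₂]
  (ch : Channel X S Y₁ Y₂)

section TimeAverage

variable {n : ℕ} (c : Code X S Y₁ n)

open Classical in
/-- The expected fraction of the time in which the state is `s` and the input is `x`. -/
def occupancy (s : S) (x : X) : ℝ :=
  ∑ w : Fin c.M, ∑ s' : Fin n → S, ∑ x' : Fin n → X,
    1 / (c.M : ℝ) * (∏ i, ch.state (s' i)) * c.enc w s' x' *
      ((∑ i, if s' i = s ∧ x' i = x then 1 else 0) / n)

theorem occupancy_nonneg (s : S) (x : X) : 0 ≤ ch.occupancy c s x :=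
  Finset.sum_nonneg fun w _ => Finset.sum_nonneg fun s' _ => Finset.sum_nonneg fun x' _ =>
    mul_nonneg (mul_nonneg (mul_nonneg (by positivity) (prod_state_nonneg ch s'))
      (stdSimplex.zero_le _ _)) (div_nonneg (Finset.sum_nonneg fun i _ => by
        split_ifs <;> norm_num) n.cast_nonneg)

theorem sum_occupancy_mul (φ : S → X → ℝ) :
    ∑ s, ∑ x, ch.occupancy c s x * φ s x =
      ∑ w : Fin c.M, ∑ s : Fin n → S, ∑ x : Fin n → X,
        1 / (c.M : ℝ) * (∏ i, ch.state (s i)) * c.enc w s x * ((∑ i, φ (s i) (x i)) / n) := by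
  classical
  unfold occupancy
  simp only [Finset.sum_mul]
  rw [sum_outputs_message_reorder (F := fun (w : Fin c.M) (s' : Fin n → S) (x' : Fin n → X) s x =>
    1 / (c.M : ℝ) * (∏ i, ch.state (s' i)) *
    c.enc w s' x' * ((∑ i, if s' i = s ∧ x' i = x then 1 else 0) / n) * φ s x)]
  refine Finset.sum_congr rfl fun w _ => Finset.sum_congr rfl fun s' _ =>
    Finset.sum_congr rfl fun x' _ => ?_
  have h : ∑ s, ∑ x, (∑ i, if s' i = s ∧ x' i = x then (1 : ℝ) else 0) * φ s x =
      ∑ i, φ (s' i) (x' i) := by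
    simp only [Finset.sum_mul]
    simp only [Finset.sum_comm (s := (Finset.univ : Finset X)) (t := (Finset.univ : Finset (Fin n)))]
    rw [Finset.sum_comm]
    refine Finset.sum_congr rfl fun i _ => ?_
    simp [ite_and]
  rw [← h, Finset.sum_div, Finset.mul_sum]
  refine Finset.sum_congr rfl fun s _ => ?_
  rw [Finset.sum_div, Finset.mul_sum]
  exact Finset.sum_congr rfl fun x _ => by ring

/-- Summing over inputs removes the encoder, and i.i.d. states spend an expected fraction exactly
`p(s₀)` of the time in `s₀`. Hence the occupancy factors as `p(s) q(x|s)`. -/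
theorem sum_occupancy (hn : 0 < n) (s₀ : S) : ∑ x, ch.occupancy c s₀ x = ch.state s₀ := by
  classical
  have hn' : (n : ℝ) ≠ 0 := by exact_mod_cast hn.ne'
  have hM : (c.M : ℝ) ≠ 0 := by exact_mod_cast c.M_pos.ne'
  have h := ch.sum_occupancy_mul c fun s _ => if s = s₀ then 1 else 0
  have h1 : ∑ s, ∑ x, ch.occupancy c s x * (if s = s₀ then 1 else 0) =
      ∑ x, ch.occupancy c s₀ x := by
    simp only [← Finset.sum_mul]
    simp
  rw [← h1, h]
  have h2 : ∀ (w : Fin c.M) (s : Fin n → S), ∑ x : Fin n → X,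
      1 / (c.M : ℝ) * (∏ i, ch.state (s i)) * c.enc w s x *
        ((∑ i, if s i = s₀ then 1 else 0) / n) =
      1 / (c.M : ℝ) / n * ∑ i, (∏ i, ch.state (s i)) * (if s i = s₀ then 1 else 0) := by
    intro w s
    rw [← Finset.sum_mul, ← Finset.mul_sum, stdSimplex.sum_eq_one, ← Finset.mul_sum]
    ring
  have h3 : ∀ i : Fin n, ∑ s : Fin n → S, (∏ i, ch.state (s i)) * (if s i = s₀ then 1 else 0) =
      ch.state s₀ := by
    intro i
    rw [sum_prod_mul_apply (fun _ : Fin n => ⇑ch.state) (fun _ => stdSimplex.sum_eq_one _) i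
      fun z => if z = s₀ then 1 else 0]
    simp
  have h4 : ∀ w : Fin c.M, ∑ s : Fin n → S, ∑ x : Fin n → X,
      1 / (c.M : ℝ) * (∏ i, ch.state (s i)) * c.enc w s x *
        ((∑ i, if s i = s₀ then 1 else 0) / n) = 1 / (c.M : ℝ) / n * (n * ch.state s₀) := by
    intro w
    simp only [h2]
    rw [← Finset.mul_sum, Finset.sum_comm]
    simp only [h3]
    simp
  simp only [h4]
  simp
  field_simp

/-- Time sharing: the time-averaged law of one letter of a code is that of some input law. -/
theorem exists_timeAverage [Nonempty X] (hn : 0 < n) : ∃ q : S → stdSimplex ℝ X,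
    ∀ φ : S → X → Y₁ → Y₂ → ℝ,
      ∑ w, ∑ s, ∑ x, ∑ a, ∑ b, ch.blockLaw c w s x a b * ∑ i, φ (s i) (x i) (a i) (b i) =
      n * ∑ s, ∑ x, ∑ a, ∑ b, ch.singleLaw q s x a b * φ s x a b := by
  classical
  have hn' : (n : ℝ) ≠ 0 := by exact_mod_cast hn.ne'
  have hq : ∀ s, ∃ q : stdSimplex ℝ X, ∀ x, ch.state s * q x = ch.occupancy c s x := by
    intro s
    have hsum := ch.sum_occupancy c hn s
    -- At a state of probability zero the occupancy vanishes too, so any conditional law will do.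
    by_cases h : ch.state s = 0
    · refine ⟨Classical.arbitrary _, fun x => ?_⟩
      rw [h] at hsum
      rw [h, zero_mul]
      exact ((Finset.sum_eq_zero_iff_of_nonneg fun x _ => ch.occupancy_nonneg c s x).1 hsum x
        (Finset.mem_univ x)).symm
    · refine ⟨⟨fun x => ch.occupancy c s x / ch.state s, fun x =>
        div_nonneg (ch.occupancy_nonneg c s x) (stdSimplex.zero_le _ _), ?_⟩, fun x => ?_⟩
      · rw [← Finset.sum_div, hsum, div_self h]
      · exact mul_div_cancel₀ _ h
  choose q hq using hq
  refine ⟨q, fun φ => ?_⟩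
  -- Given inputs and states, the outputs at time `i` depend only on `(x i, s i)`, so they average
  -- out to a function of that pair, to which `sum_occupancy_mul` applies.
  have hblock : ∀ (w : Fin c.M) (s : Fin n → S) (x : Fin n → X),
      ∑ a, ∑ b, ch.blockLaw c w s x a b * ∑ i, φ (s i) (x i) (a i) (b i) =
      n * (1 / (c.M : ℝ) * (∏ i, ch.state (s i)) * c.enc w s x *
        ((∑ i, ∑ a, ∑ b, ch.trans (x i) (s i) (a, b) * φ (s i) (x i) a b) / n)) := by
    intro w s x
    have h1 : ∀ i : Fin n, ∑ a : Fin n → Y₁, ∑ b : Fin n → Y₂,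
        (∏ j, ch.trans (x j) (s j) (a j, b j)) * φ (s i) (x i) (a i) (b i) =
        ∑ a, ∑ b, ch.trans (x i) (s i) (a, b) * φ (s i) (x i) a b := by
      intro i
      rw [sum_pi_prod, ← Fintype.sum_prod_type'
        (f := fun a b => ch.trans (x i) (s i) (a, b) * φ (s i) (x i) a b)]
      exact sum_prod_mul_apply (fun j : Fin n => ⇑(ch.trans (x j) (s j)))
        (fun _ => stdSimplex.sum_eq_one _) i fun z => φ (s i) (x i) z.1 z.2
    simp only [← h1, blockLaw, mul_assoc, ← Finset.mul_sum]
    have h2 : ∑ a : Fin n → Y₁, ∑ b : Fin n → Y₂, (∏ j, ch.trans (x j) (s j) (a j, b j)) *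
        ∑ i, φ (s i) (x i) (a i) (b i) = ∑ i, ∑ a : Fin n → Y₁, ∑ b : Fin n → Y₂,
        (∏ j, ch.trans (x j) (s j) (a j, b j)) * φ (s i) (x i) (a i) (b i) := by
      rw [Finset.sum_comm (s := (Finset.univ : Finset (Fin n)))]
      refine Finset.sum_congr rfl fun a _ => ?_
      rw [Finset.sum_comm (s := (Finset.univ : Finset (Fin n)))]
      exact Finset.sum_congr rfl fun b _ => Finset.mul_sum _ _ _
    rw [h2]
    field_simp
  simp only [hblock, ← Finset.mul_sum]
  rw [← ch.sum_occupancy_mul c fun s x => ∑ a, ∑ b, ch.trans x s (a, b) * φ s x a b]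
  congr 1
  refine Finset.sum_congr rfl fun s _ => Finset.sum_congr rfl fun x _ => ?_
  simp only [singleLaw, hq, mul_assoc, ← Finset.mul_sum]

/-- The converse for one code: for some input law, the rate is bounded by both entropies. -/
theorem exists_logb_card_le [Nonempty X] (hn : 0 < n) : ∃ q : S → stdSimplex ℝ X,
    Real.logb 2 c.M ≤ n * min (ch.entropyGivenState q) (ch.entropyGivenEve q) + ch.leakage c +
      1 + ch.errorProb c * Real.logb 2 c.M := by
  obtain ⟨q, hq⟩ := ch.exists_timeAverage c hn
  refine ⟨q, ?_⟩
  have hbl := ch.blockLaw_nonneg c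
  have hM : (c.M : ℝ) ≠ 0 := by exact_mod_cast c.M_pos.ne'
  have hS := logb_card_le c.M_pos (fun w (a : Fin n → Y₁) (s : Fin n → S) =>
      ∑ x, ∑ b, ch.blockLaw c w s x a b)
    (fun w a s => Finset.sum_nonneg fun x _ => Finset.sum_nonneg fun b _ => hbl w s x a b)
    (fun w => by rw [sum_output_state_reorder (ch.blockLaw c w), sum_blockLaw_of_message]) c.dec
  have hE := logb_card_le c.M_pos (fun w (a : Fin n → Y₁) (b : Fin n → Y₂) =>
      ∑ s, ∑ x, ch.blockLaw c w s x a b)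
    (fun w a b => Finset.sum_nonneg fun s _ => Finset.sum_nonneg fun x _ => hbl w s x a b)
    (fun w => by rw [sum_outputs_reorder (ch.blockLaw c w), sum_blockLaw_of_message]) c.dec
  have hSerr : (∑ w, ∑ a : Fin n → Y₁, ∑ s : Fin n → S, if c.dec a = w then 0 else
      ∑ x, ∑ b, ch.blockLaw c w s x a b) = ch.errorProb c := by
    unfold errorProb
    refine Finset.sum_congr rfl fun w _ => ?_
    rw [← sum_output_state_reorder (fun s x a b =>
      if c.dec a = w then 0 else ch.blockLaw c w s x a b)]
    refine Finset.sum_congr rfl fun a _ => Finset.sum_congr rfl fun s _ => ?_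
    split_ifs <;> simp
  have hEerr : (∑ w, ∑ a : Fin n → Y₁, ∑ b : Fin n → Y₂, if c.dec a = w then 0 else
      ∑ s, ∑ x, ch.blockLaw c w s x a b) = ch.errorProb c := by
    unfold errorProb
    refine Finset.sum_congr rfl fun w _ => ?_
    rw [← sum_outputs_reorder (fun s x a b =>
      if c.dec a = w then 0 else ch.blockLaw c w s x a b)]
    refine Finset.sum_congr rfl fun a _ => Finset.sum_congr rfl fun b _ => ?_
    split_ifs <;> simp
  have hSinfo : mutualInfo (fun z : Fin c.M × (Fin n → S) =>
      ∑ a, ∑ x, ∑ b, ch.blockLaw c z.1 z.2 x a b) = 0 := by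
    have : ∀ (w : Fin c.M) (s : Fin n → S), ∑ a, ∑ x, ∑ b, ch.blockLaw c w s x a b =
        1 / (c.M : ℝ) * ∏ i, ch.state (s i) := fun w s => by
      rw [Finset.sum_comm, sum_blockLaw_of_message_state]
    simp only [this]
    exact mutualInfo_mul (fun _ : Fin c.M => 1 / (c.M : ℝ)) (fun s : Fin n → S =>
      ∏ i, ch.state (s i)) (by simp [hM]) (sum_prod_state ch)
  have hEinfo : mutualInfo (fun z : Fin c.M × (Fin n → Y₂) =>
      ∑ a, ∑ s, ∑ x, ch.blockLaw c z.1 s x a z.2) = ch.leakage c := by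
    unfold leakage
    congr 1
    funext z
    rw [Finset.sum_comm]
    exact Finset.sum_congr rfl fun s _ => Finset.sum_comm
  have hSent : condEntropy (fun z : (Fin n → Y₁) × (Fin n → S) =>
      ∑ w, ∑ x, ∑ b, ch.blockLaw c w z.2 x z.1 b) ≤ n * ch.entropyGivenState q := by
    refine condEntropy_block_le _ (fun z => Finset.sum_nonneg fun w _ => Finset.sum_nonneg
      fun x _ => Finset.sum_nonneg fun b _ => hbl _ _ _ _ _) _ (fun z => Finset.sum_nonneg
      fun x _ => Finset.sum_nonneg fun b _ => ch.singleLaw_nonneg q _ _ _ _) fun φ => ?_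
    have h := hq fun s _ a _ => φ a s
    simp only [Finset.sum_mul]
    rw [sum_output_state_message_reorder (fun w (s : Fin n → S) x (a : Fin n → Y₁) b =>
      ch.blockLaw c w s x a b * ∑ i, φ (a i) (s i)), h,
      ← sum_output_state_reorder (fun s x a b => ch.singleLaw q s x a b * φ a s)]
  have hEent : condEntropy (fun z : (Fin n → Y₁) × (Fin n → Y₂) =>
      ∑ w, ∑ s, ∑ x, ch.blockLaw c w s x z.1 z.2) ≤ n * ch.entropyGivenEve q := by
    refine condEntropy_block_le _ (fun z => Finset.sum_nonneg fun w _ => Finset.sum_nonneg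
      fun s _ => Finset.sum_nonneg fun x _ => hbl _ _ _ _ _) _ (fun z => Finset.sum_nonneg
      fun s _ => Finset.sum_nonneg fun x _ => ch.singleLaw_nonneg q _ _ _ _) fun φ => ?_
    have h := hq fun _ _ a b => φ a b
    simp only [Finset.sum_mul]
    rw [sum_outputs_message_reorder (fun w s x (a : Fin n → Y₁) (b : Fin n → Y₂) =>
      ch.blockLaw c w s x a b * ∑ i, φ (a i) (b i)), h,
      ← sum_outputs_reorder (fun s x a b => ch.singleLaw q s x a b * φ a b)]
  rw [hSerr, hSinfo] at hS
  rw [hEerr, hEinfo] at hE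
  -- The bound obtained from `S^n` carries no leakage term; nonnegativity allows adding it.
  have hleak := ch.leakage_nonneg c
  rw [mul_min_of_nonneg _ _ n.cast_nonneg]
  rcases min_choice (n * ch.entropyGivenState q) (n * ch.entropyGivenEve q) with h | h <;>
    rw [h] <;> linarith

end TimeAverage

/-- An achievable secrecy rate is at most any upper bound of the single-letter expressions. -/
theorem Achievable.le [Nonempty X] {ch : Channel X S Y₁ Y₂} {R m : ℝ} (hR : ch.Achievable R)
    (hm : ∀ q : S → stdSimplex ℝ X,
      min (ch.entropyGivenState q) (ch.entropyGivenEve q) ≤ m) : R ≤ m := by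
  obtain ⟨c, hrate, herr, hleak⟩ := hR
  refine le_of_forall_pos_le_add fun ε hε => ?_
  have hlim₁ : Tendsto (fun n => (R - ε) * (1 - ch.errorProb (c n))) atTop (𝓝 (R - ε)) := by
    simpa using (herr.const_sub 1).const_mul (R - ε)
  have hlim₂ : Tendsto (fun n : ℕ => m + ch.leakage (c n) / n + 1 / n) atTop (𝓝 m) := by
    simpa using (hleak.const_add m).add (tendsto_const_div_atTop_nhds_zero_nat 1)
  have hle : R - ε ≤ m := by
    refine le_of_tendsto_of_tendsto hlim₁ hlim₂ ?_
    filter_upwards [hrate ε hε, herr.eventually_lt_const one_pos, eventually_gt_atTop 0]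
      with n h1 h2 hn
    have hn' : (0 : ℝ) < n := by exact_mod_cast hn
    obtain ⟨q, hq⟩ := ch.exists_logb_card_le (c n) hn
    -- With `Pₑ < 1`, it remains to bound `rate * (1 - Pₑ)`: this is the one-code bound with `Pₑ log
    -- M` moved to the left, divided by `n`.
    refine (mul_le_mul_of_nonneg_right h1 (by linarith)).trans ?_
    have h3 : (n : ℝ) * min (ch.entropyGivenState q) (ch.entropyGivenEve q) ≤ n * m :=
      mul_le_mul_of_nonneg_left (hm q) hn'.le
    have e : m + ch.leakage (c n) / n + 1 / n = (n * m + ch.leakage (c n) + 1) / n := by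
      field_simp
    rw [e, Code.rate, le_div_iff₀ hn', mul_right_comm, div_mul_cancel₀ _ hn'.ne']
    linarith
  linarith

/-! ### Continuity in the input law, and the capacity formula. -/

theorem continuous_singleLaw (s : S) (x : X) (a : Y₁) (b : Y₂) :
    Continuous fun q : S → stdSimplex ℝ X => ch.singleLaw q s x a b := by
  have : Continuous fun q : S → stdSimplex ℝ X => q s x :=
    (continuous_apply x).comp (continuous_subtype_val.comp (continuous_apply s))
  exact (continuous_const.mul this).mul continuous_const

theorem continuous_min_entropy : Continuous fun q : S → stdSimplex ℝ X =>
    min (ch.entropyGivenState q) (ch.entropyGivenEve q) := by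
  refine Continuous.min ?_ ?_
  · exact continuous_condEntropy _ (fun q z => Finset.sum_nonneg fun x _ => Finset.sum_nonneg
      fun b _ => ch.singleLaw_nonneg q _ _ _ _) fun z => continuous_finsetSum _ fun x _ =>
      continuous_finsetSum _ fun b _ => ch.continuous_singleLaw _ _ _ _
  · exact continuous_condEntropy _ (fun q z => Finset.sum_nonneg fun s _ => Finset.sum_nonneg
      fun x _ => ch.singleLaw_nonneg q _ _ _ _) fun z => continuous_finsetSum _ fun s _ =>
      continuous_finsetSum _ fun x _ => ch.continuous_singleLaw _ _ _ _

end Channel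

end Wiretap

end

theorem theorem1 {X S Y₁ Y₂ : Type*} [Fintype X] [Nonempty X] [Fintype S] [Fintype Y₁]
    [Fintype Y₂] (ch : Wiretap.Channel X S Y₁ Y₂) (f : X → S → Y₁)
    (hf : ch.IsSemiDeterministic f) :
    IsGreatest {R : ℝ | ch.Achievable R} ch.secrecyCapacity ∧
    IsGreatest
      (Set.range fun q : S → stdSimplex ℝ X => min (ch.entropyGivenState q) (ch.entropyGivenEve q))
      ch.secrecyCapacity := by
  obtain ⟨q, -, hq⟩ := isCompact_univ.exists_isMaxOn Set.univ_nonempty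
    ch.continuous_min_entropy.continuousOn
  have hmax : ∀ q', min (ch.entropyGivenState q') (ch.entropyGivenEve q') ≤
      min (ch.entropyGivenState q) (ch.entropyGivenEve q) := fun q' => hq (Set.mem_univ q')
  have hgreatest : IsGreatest {R : ℝ | ch.Achievable R}
      (min (ch.entropyGivenState q) (ch.entropyGivenEve q)) :=
    ⟨hf.achievable q, fun R hR => hR.le hmax⟩
  have hcap : ch.secrecyCapacity = min (ch.entropyGivenState q) (ch.entropyGivenEve q) :=
    hgreatest.csSup_eq
  rw [hcap]
  exact ⟨hgreatest, ⟨q, rfl⟩, by rintro _ ⟨q', rfl⟩; exact hmax q'⟩
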